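/- Let $\mathbb N=\{0,1,2,\dots\}$, $\mathbb N^*=\{1,2,\dots\}$, $m\in\mathbb N^*$, $I_m=\{(j,\alpha)\in\mathbb N^2 : j+\alpha\le m,\ j<m\}$, and let $F(t,x,z)$, $z=(z_{j,\alpha})_{(j,\alpha)\in I_m}$, be holomorphic in a polydisk $\Delta$ centred at the origin, with $F(0,x,0)\equiv 0$ in $\Delta\cap\{t=0,z=0\}$. Write $$F(t,x,z)=a(x)t+\sum_{(j,\alpha)\in I_m} b_{j,\alpha}(x)z_{j,\alpha}+R_2(t,x,z),\qquad R_2=\sum_{i+|\nu|\ge 2}a_{i,\nu}(x)t^iz^\nu .$$ Assume $b_{j,\alpha}(x)=O(x^\alpha)$ as $x\to0$ for all $(j,\alpha)\in I_m$ with $\alpha>0$; write $b_{j,\alpha}(x)=x^\alpha c_{j,\alpha}(x)$ for $(j,\alpha)\in I_m$ and put $c_{m,0}=-1$. Define: * $L(\lambda,\rho)=\lambda^m-\sum_{(j,\alpha)\in I_m}c_{j,\alpha}(0)\lambda^j\rho(\rho-1)\cdots(\rho-\alpha+1)$; * $\Lambda_0=\{(m,0)\}\cup\{(j,\alpha)\in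 I_m : c_{j,\alpha}(0)\ne0\}$ and $\Lambda_1=\{(j,\alpha)\in I_m : c_{j,\alpha}(0)=0,\ c_{j,\alpha}\not\equiv0\}$; * the Newton polygon $\mathcal N_0\subset\mathbb R^2$, the convex hull of $\bigcup_{(j,\alpha)\in\Lambda_0}\{(x,y): x\le j,\ y\le\alpha\}$. Its boundary consists of a vertical half line, finitely many (possibly no) bounded edges, and a horizontal half line $\Gamma_{\mathrm h}$; * for a bounded edge $\Gamma$ whose left end point has abscissa $m'$, the polynomial $P_\Gamma(X)=\sum_{(j,\alpha)\in\Lambda_0\cap\Gamma}c_{j,\alpha}(0)X^{j-m'}$; for $\Gamma_{\mathrm h}$, whose end point has abscissa $m_{\mathrm h}$, the polynomial $P_{\mathrm h}(X)=\sum_{(j,\alpha)\in\Lambda_0\cap\Gamma_{\mathrm h}}c_{j,\alpha}(0)X^{j}$ if $m_{\mathrm h}\ge1$, and $P_{\mathrm h}=1$ if $m_{\mathrm h}=0$; * for $(j,\alpha)\in\Lambda_1$, $p_{j,\alpha}\ge1$, the order of the zero of $c_{j,\alpha}(x)$ at $x=0$, and $d_{j,\alpha}=\min\{y\in\mathbb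 R : (j,\alpha-y)\in\mathcal N_0\}$; then $$\sigma_0=\max\Bigl[1,\ \max_{(j,\alpha)\in\Lambda_1}\frac{p_{j,\alpha}+d_{j,\alpha}}{p_{j,\alpha}}\Bigr];$$ * for $0\le\mu<m$, $I_{m,\mu}=\{(j,\alpha)\in I_m : \alpha>\mu,\ (\partial_{z_{j,\alpha}}\partial_x^{\mu}R_2)(t,0,z)\not\equiv0\}$. Assume further * (N) $L(k,l)\neq0$ for all $(k,l)\in\mathbb N^*\times\mathbb N$; * (GP) for every bounded edge $\Gamma$ of $\mathcal N_0$ no root of $P_\Gamma$ lies in $[0,\infty)$, and no root of $P_{\mathrm h}$ lies in $\mathbb N^*$; * $\displaystyle \sigma_0\le\frac{m-j-\mu}{\alpha-\mu}$ for all $0\le\mu<m$ and all $(j,\alpha)\in I_{m,\mu}$. Then the equation $$(t\partial_t)^mu=F\bigl(t,x,\{(t\partial_t)^j\partial_x^\alpha u\}_{(j,\alpha)\in I_m}\bigr)$$ has a unique formal power series solution $u(t,x)=\sum_{k,l\ge 0}u_{k,l}t^kx^l\in\mathbb C[[t,x]]$ with $u(0,x)\equiv0$, and it lies in the formal Gevrey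 class $G\{t,x\}_{(1,\sigma_0)}$, that is, $\sum_{k,l\ge0}\frac{u_{k,l}}{l!^{\,\sigma_0-1}}t^kx^l$ converges in a neighbourhood of $(0,0)$. Consequently $u$ is holomorphic in $t$: there is $R>0$ such that for every $l\in\mathbb N$ the series $\sum_k u_{k,l}t^k$ converges to a holomorphic function on $|t|<R$. -/

import Mathlib

noncomputable section

namespace TotChar

open scoped Nat

/-! ### The equation -/

/-- The index set `I_m = {(j, α) ; j + α ≤ m, j < m}`. -/
def indexSet (m : ℕ) : Finset (ℕ × ℕ) :=
  (Finset.range m ×ˢ Finset.range (m + 1)).filter fun q => q.1 + q.2 ≤ m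

/-- The variables of `F(t, x, z)`: `t`, `x` and one variable `z_{j,α}` for each
`(j, α) ∈ I_m`. -/
abbrev Var (m : ℕ) : Type := Fin 2 ⊕ {q : ℕ × ℕ // q ∈ indexSet m}

/-- The variable `t` of `F`. -/
abbrev varT (m : ℕ) : Var m := Sum.inl 0

/-- The variable `x` of `F`. -/
abbrev varX (m : ℕ) : Var m := Sum.inl 1

/-- The variable `z_{j,α}` of `F`. -/
abbrev varZ {m : ℕ} (q : {q : ℕ × ℕ // q ∈ indexSet m}) : Var m := Sum.inr q

/-- The open polydisk with centre `0` and polyradius `r`. -/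
def polydisk {ι : Type*} (r : ι → ℝ) : Set (ι → ℂ) := {z | ∀ v, ‖z v‖ < r v}

/-- The formal Taylor series at the origin: the coefficient of `z ^ n` is `∂ⁿ F(0) / n!`. The
mixed partial derivative `∂ⁿ F(0)` is the derivative of order `|n|` of `F` at `0`, applied to
coordinate vectors, the `v`-th of which occurs `n v` times (for holomorphic `F` their order does
not matter). -/
def taylorSeries {ι : Type*} [Fintype ι] [DecidableEq ι] (F : (ι → ℂ) → ℂ) :
    MvPowerSeries ι ℂ := fun n =>
  iteratedFDeriv ℂ n.toMultiset.toList.length F 0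
      (fun i => Pi.single (n.toMultiset.toList.get i) 1) / ((∏ v, (n v)! : ℕ) : ℂ)

/-- The Euler operator `t ∂_t` on `ℂ[[t, x]]`, where `t` is the variable `0` and `x` the
variable `1`. -/
def eulerT (u : MvPowerSeries (Fin 2) ℂ) : MvPowerSeries (Fin 2) ℂ :=
  MvPowerSeries.X 0 * MvPowerSeries.pderiv ℂ 0 u

/-- The series substituted for the variables of `F`: `t` for `t`, `x` for `x`, and
`(t ∂_t)^j ∂_x^α u` for `z_{j,α}`. -/
def jet (m : ℕ) (u : MvPowerSeries (Fin 2) ℂ) : Var m → MvPowerSeries (Fin 2) ℂ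
  | Sum.inl i => MvPowerSeries.X i
  | Sum.inr q => eulerT^[q.1.1] ((MvPowerSeries.pderiv ℂ 1)^[q.1.2] u)

/-- `u ∈ ℂ[[t, x]]` is a formal solution with `u(0, x) ≡ 0` of the equation
`(t ∂_t)^m u = F(t, x, {(t ∂_t)^j ∂_x^α u}_{(j,α) ∈ I_m})`. As `u(0, x) ≡ 0`, all the series in
`jet m u` have zero constant term, so that the substitution makes sense. -/
structure IsFormalSolution {m : ℕ} (F : (Var m → ℂ) → ℂ) (u : MvPowerSeries (Fin 2) ℂ) :
    Prop where
  zero_at_t_zero : ∀ n : Fin 2 →₀ ℕ, n 0 = 0 → MvPowerSeries.coeff n u = 0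
  equation : eulerT^[m] u = MvPowerSeries.subst (jet m u) (taylorSeries F)

/-! ### The coefficients of the linear part -/

/-- The coefficient `b_{j,α}(x)` of `z_{j,α}` in the expansion of `F` in powers of `(t, z)`, as
a power series in `x`. -/
def coeffB {m : ℕ} (F : (Var m → ℂ) → ℂ) (q : {q : ℕ × ℕ // q ∈ indexSet m}) :
    PowerSeries ℂ :=
  PowerSeries.mk fun l => MvPowerSeries.coeff
    (Finsupp.single (varX m) l + Finsupp.single (varZ q) 1) (taylorSeries F)

/-- The condition `b_{j,α}(x) = O(x^α)` for all `(j, α) ∈ I_m` with `α > 0`. -/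
def TotallyCharacteristic {m : ℕ} (F : (Var m → ℂ) → ℂ) : Prop :=
  ∀ q : {q : ℕ × ℕ // q ∈ indexSet m}, 0 < q.1.2 →
    (PowerSeries.X : PowerSeries ℂ) ^ q.1.2 ∣ coeffB F q

/-- The power series `c_{j,α}(x)` with `b_{j,α}(x) = x^α c_{j,α}(x)` for `(j, α) ∈ I_m`, and
`c_{m,0} = -1`. (All other pairs get the value `0`.) -/
def coeffC {m : ℕ} (F : (Var m → ℂ) → ℂ) (q : ℕ × ℕ) : PowerSeries ℂ :=
  if h : q ∈ indexSet m then
    PowerSeries.mk fun l => PowerSeries.coeff (l + q.2) (coeffB F ⟨q, h⟩)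
  else if q = (m, 0) then -1 else 0

/-- The value `c_{j,α}(0)`. -/
def coeffC0 {m : ℕ} (F : (Var m → ℂ) → ℂ) (q : ℕ × ℕ) : ℂ :=
  PowerSeries.constantCoeff (coeffC F q)

/-- `L(λ, ρ) = λ^m - ∑_{(j,α) ∈ I_m} c_{j,α}(0) λ^j ρ (ρ - 1) ⋯ (ρ - α + 1)`. -/
def indicial {m : ℕ} (F : (Var m → ℂ) → ℂ) (lam rho : ℂ) : ℂ :=
  lam ^ m - ∑ q ∈ indexSet m,
    coeffC0 F q * lam ^ q.1 * ∏ i ∈ Finset.range q.2, (rho - (i : ℂ))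

/-- The non-resonance condition (N). -/
def NonResonance {m : ℕ} (F : (Var m → ℂ) → ℂ) : Prop :=
  ∀ k l : ℕ, 1 ≤ k → indicial F k l ≠ 0

/-! ### The Newton polygon and the generalized Poincaré condition -/

open Classical in
/-- `Λ₀ = {(m, 0)} ∪ {(j, α) ∈ I_m ; c_{j,α}(0) ≠ 0}`. -/
def lambda0 {m : ℕ} (F : (Var m → ℂ) → ℂ) : Finset (ℕ × ℕ) :=
  {(m, 0)} ∪ (indexSet m).filter fun q => coeffC0 F q ≠ 0

/-- A pair of natural numbers as a point of the plane. -/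
def toPlane (q : ℕ × ℕ) : ℝ × ℝ := (q.1, q.2)

/-- The Newton polygon at `x = 0`: the convex hull of the union of the quadrants
`{(x, y) ; x ≤ j, y ≤ α}` for `(j, α) ∈ Λ₀`. -/
def newtonPolygon {m : ℕ} (F : (Var m → ℂ) → ℂ) : Set (ℝ × ℝ) :=
  convexHull ℝ (⋃ q ∈ lambda0 F, Set.Iic (toPlane q))

/-- The face of the Newton polygon on which `s x + y` is maximal, that is, its intersection with
its supporting line of slope `-s` from above. If `s > 0` it is a vertex or one of the bounded
edges; for `s = 0` it is the horizontal half line of the boundary. -/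
def face {m : ℕ} (F : (Var m → ℂ) → ℂ) (s : ℝ) : Set (ℝ × ℝ) :=
  {P | P ∈ newtonPolygon F ∧ ∀ Q ∈ newtonPolygon F, s * Q.1 + Q.2 ≤ s * P.1 + P.2}

/-- `-s` is the slope of a bounded edge (of positive length) of the Newton polygon. -/
def IsEdgeSlope {m : ℕ} (F : (Var m → ℂ) → ℂ) (s : ℝ) : Prop :=
  0 < s ∧ (face F s).Nontrivial

open Classical in
/-- `Λ₀ ∩ Γ` for the face `Γ` of slope `-s`. -/
def lambda0Face {m : ℕ} (F : (Var m → ℂ) → ℂ) (s : ℝ) : Finset (ℕ × ℕ) :=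
  (lambda0 F).filter fun q => toPlane q ∈ face F s

/-- The abscissa of the left end point of the bounded edge of slope `-s`; the end points of the
edges are vertices of the polygon, hence points of `Λ₀`. -/
def leftEnd {m : ℕ} (F : (Var m → ℂ) → ℂ) (s : ℝ) : ℕ :=
  sInf {j : ℕ | ∃ q ∈ lambda0Face F s, q.1 = j}

/-- The characteristic polynomial `∑_{(j,α) ∈ Λ₀ ∩ Γ} c_{j,α}(0) X^{j - m'}` on the bounded edge
`Γ` of slope `-s`, with `m'` the abscissa of its left end point. -/
def charPoly {m : ℕ} (F : (Var m → ℂ) → ℂ) (s : ℝ) : Polynomial ℂ :=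
  ∑ q ∈ lambda0Face F s,
    Polynomial.C (coeffC0 F q) * Polynomial.X ^ (q.1 - leftEnd F s)

/-- The abscissa `m_p` of the end point of the horizontal half line of the boundary. -/
def lastAbscissa {m : ℕ} (F : (Var m → ℂ) → ℂ) : ℕ := (lambda0Face F 0).sup fun q => q.1

/-- The characteristic polynomial on the horizontal half line `Γ_p` of the boundary: `1` if
`m_p = 0`, and `∑_{(j,α) ∈ Λ₀ ∩ Γ_p} c_{j,α}(0) X^j` if `m_p ≥ 1`. -/
def lastCharPoly {m : ℕ} (F : (Var m → ℂ) → ℂ) : Polynomial ℂ :=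
  if lastAbscissa F = 0 then 1
  else ∑ q ∈ lambda0Face F 0, Polynomial.C (coeffC0 F q) * Polynomial.X ^ q.1

/-- The generalized Poincaré condition (GP): no characteristic root on a bounded edge lies in
`[0, ∞)`, and no characteristic root on the horizontal half line lies in `{1, 2, 3, …}`. -/
structure GeneralizedPoincare {m : ℕ} (F : (Var m → ℂ) → ℂ) : Prop where
  edges : ∀ s : ℝ, IsEdgeSlope F s → ∀ lam : ℂ, (charPoly F s).IsRoot lam →
    ¬ ∃ a : ℝ, 0 ≤ a ∧ lam = (a : ℂ)
  last : ∀ lam : ℂ, (lastCharPoly F).IsRoot lam → ¬ ∃ k : ℕ, 1 ≤ k ∧ lam = (k : ℂ)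

/-! ### The irregularity at `x = 0` -/

/-- `Λ₁ = {(j, α) ∈ I_m ; c_{j,α}(0) = 0, c_{j,α}(x) ≢ 0}`. -/
def lambda1 {m : ℕ} (F : (Var m → ℂ) → ℂ) : Set (ℕ × ℕ) :=
  {q | q ∈ indexSet m ∧ coeffC0 F q = 0 ∧ coeffC F q ≠ 0}

/-- `p_{j,α}`, the order of the zero of `c_{j,α}(x)` at `x = 0`. -/
def zeroOrder {m : ℕ} (F : (Var m → ℂ) → ℂ) (q : ℕ × ℕ) : ℕ := (coeffC F q).order.toNat

/-- `d_{j,α} = min {y ∈ ℝ ; (j, α - y) ∈ N₀}`. -/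
def excess {m : ℕ} (F : (Var m → ℂ) → ℂ) (q : ℕ × ℕ) : ℝ :=
  sInf {y : ℝ | ((q.1 : ℝ), (q.2 : ℝ) - y) ∈ newtonPolygon F}

/-- The irregularity `σ₀` at `x = 0`: the maximum of `1` and of the numbers
`(p_{j,α} + d_{j,α}) / p_{j,α}` for `(j, α) ∈ Λ₁` (a finite set). -/
def irregularity {m : ℕ} (F : (Var m → ℂ) → ℂ) : ℝ :=
  sSup (insert 1 ((fun q => ((zeroOrder F q : ℝ) + excess F q) / (zeroOrder F q : ℝ)) ''
    lambda1 F))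

/-! ### The nonlinear part -/

/-- `R₂(t, x, z)`: the part of the expansion of `F` in powers of `(t, z)` which consists of the
terms `a_{i,ν}(x) t^i z^ν` with `i + |ν| ≥ 2`. -/
def nonlinearPart {m : ℕ} (F : (Var m → ℂ) → ℂ) : MvPowerSeries (Var m) ℂ := fun n =>
  if 2 ≤ n (varT m) + ∑ q, n (varZ q) then MvPowerSeries.coeff n (taylorSeries F) else 0

/-- The restriction `f(t, 0, z)` of `f(t, x, z)` to `x = 0`. -/
def restrictX {m : ℕ} (f : MvPowerSeries (Var m) ℂ) : MvPowerSeries (Var m) ℂ := fun n =>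
  if n (varX m) = 0 then MvPowerSeries.coeff n f else 0

/-- `I_{m,μ} = {(j, α) ∈ I_m ; α > μ, (∂_{z_{j,α}} ∂_x^μ R₂)(t, 0, z) ≢ 0}`. -/
def indexSetMu {m : ℕ} (F : (Var m → ℂ) → ℂ) (mu : ℕ) :
    Set {q : ℕ × ℕ // q ∈ indexSet m} :=
  {q | mu < q.1.2 ∧
    restrictX (MvPowerSeries.pderiv ℂ (varZ q)
      ((MvPowerSeries.pderiv ℂ (varX m))^[mu] (nonlinearPart F))) ≠ 0}

/-! ### Formal Gevrey classes -/

/-- The coefficient `u_{k,l}` of `t^k x^l`. -/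
def coeffTX (u : MvPowerSeries (Fin 2) ℂ) (k l : ℕ) : ℂ :=
  MvPowerSeries.coeff (Finsupp.single 0 k + Finsupp.single 1 l) u

/-- The formal Gevrey class `G{t, x}_{(s,σ)}` (for `s, σ ≥ 1`): the series `∑ u_{k,l} t^k x^l`
such that `∑ u_{k,l} / (k!^{s-1} l!^{σ-1}) t^k x^l` converges in a neighbourhood of `(0, 0)`. -/
def gevreyClass (s σ : ℝ) : Set (MvPowerSeries (Fin 2) ℂ) :=
  {u | ∀ᶠ P : ℂ × ℂ in nhds 0, Summable fun n : ℕ × ℕ =>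
    coeffTX u n.1 n.2 / (((n.1 ! : ℝ) ^ (s - 1) * (n.2 ! : ℝ) ^ (σ - 1) : ℝ) : ℂ) *
      P.1 ^ n.1 * P.2 ^ n.2}

/-- `u(t, x)` is holomorphic in `t`: when it is written as a power series `∑ g_l(t) x^l` in `x`,
the coefficients `g_l(t) = ∑_k u_{k,l} t^k` converge to holomorphic functions on a common disk
with centre `0`. -/
def HolomorphicInT (u : MvPowerSeries (Fin 2) ℂ) : Prop :=
  ∃ R : ℝ, 0 < R ∧ ∃ g : ℕ → ℂ → ℂ, ∀ l : ℕ, DifferentiableOn ℂ (g l) (Metric.ball 0 R) ∧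
    ∀ t ∈ Metric.ball (0 : ℂ) R, HasSum (fun k : ℕ => coeffTX u k l * t ^ k) (g l t)

end TotChar

end

namespace TotChar

open Finset

/-! ### Coefficients of series in two variables -/

theorem exponent_eq (n : Fin 2 →₀ ℕ) :
    Finsupp.single 0 (n 0) + Finsupp.single 1 (n 1) = n := by
  ext i; fin_cases i <;> simp

theorem coeff_eq_coeffTX (f : MvPowerSeries (Fin 2) ℂ) (n : Fin 2 →₀ ℕ) :
    MvPowerSeries.coeff n f = coeffTX f (n 0) (n 1) := by
  rw [coeffTX, exponent_eq]

theorem ext_coeffTX {f g : MvPowerSeries (Fin 2) ℂ}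
    (h : ∀ k l, coeffTX f k l = coeffTX g k l) : f = g := by
  ext n; rw [coeff_eq_coeffTX, coeff_eq_coeffTX, h]

/-- The series with prescribed coefficients. -/
noncomputable def ofCoeff (c : ℕ → ℕ → ℂ) : MvPowerSeries (Fin 2) ℂ := fun n => c (n 0) (n 1)

@[simp] theorem coeffTX_ofCoeff (c : ℕ → ℕ → ℂ) (k l : ℕ) : coeffTX (ofCoeff c) k l = c k l := by
  simp [coeffTX, ofCoeff, MvPowerSeries.coeff_apply]

theorem coeffTX_one (k l : ℕ) :
    coeffTX 1 k l = if k = 0 ∧ l = 0 then 1 else 0 := by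
  classical
  rw [coeffTX, MvPowerSeries.coeff_one]
  refine if_congr ⟨fun h => ?_, ?_⟩ rfl rfl
  · have h0 := DFunLike.congr_fun h 0
    have h1 := DFunLike.congr_fun h 1
    simp at h0 h1
    exact ⟨h0, h1⟩
  · rintro ⟨rfl, rfl⟩; simp

theorem coeffTX_mul (f g : MvPowerSeries (Fin 2) ℂ) (k l : ℕ) :
    coeffTX (f * g) k l = ∑ a ∈ HasAntidiagonal.antidiagonal k, ∑ b ∈ HasAntidiagonal.antidiagonal l,
      coeffTX f a.1 b.1 * coeffTX g a.2 b.2 := by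
  classical
  rw [coeffTX, MvPowerSeries.coeff_mul, ← Finset.sum_product']
  refine Finset.sum_bij' (fun p _ => ((p.1 0, p.2 0), (p.1 1, p.2 1)))
    (fun a _ => (Finsupp.single 0 a.1.1 + Finsupp.single 1 a.2.1,
      Finsupp.single 0 a.1.2 + Finsupp.single 1 a.2.2)) ?_ ?_ ?_ ?_ ?_
  · intro p hp
    rw [HasAntidiagonal.mem_antidiagonal] at hp
    have h0 := DFunLike.congr_fun hp 0
    have h1 := DFunLike.congr_fun hp 1
    simp at h0 h1
    simp [h0, h1]
  · intro a ha
    simp only [mem_product, HasAntidiagonal.mem_antidiagonal] at ha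
    rw [HasAntidiagonal.mem_antidiagonal]
    ext i; fin_cases i <;> simp [← ha.1, ← ha.2]
  · intro p _; simp [exponent_eq]
  · intro a _; simp
  · intro p _; simp [coeff_eq_coeffTX]

theorem coeffTX_X_zero_mul (f : MvPowerSeries (Fin 2) ℂ) (k l : ℕ) :
    coeffTX (MvPowerSeries.X 0 * f) k l = if k = 0 then 0 else coeffTX f (k - 1) l := by
  classical
  rw [coeffTX, MvPowerSeries.X, MvPowerSeries.coeff_monomial_mul]
  cases k with
  | zero => simp
  | succ k =>
    rw [if_pos (by intro i; fin_cases i <;> simp), coeff_eq_coeffTX]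
    simp

theorem coeffTX_X_one_mul (f : MvPowerSeries (Fin 2) ℂ) (k l : ℕ) :
    coeffTX (MvPowerSeries.X 1 * f) k l = if l = 0 then 0 else coeffTX f k (l - 1) := by
  classical
  rw [coeffTX, MvPowerSeries.X, MvPowerSeries.coeff_monomial_mul]
  cases l with
  | zero => simp
  | succ k =>
    rw [if_pos (by intro i; fin_cases i <;> simp), coeff_eq_coeffTX]
    simp

theorem coeffTX_X_zero_pow_mul (i : ℕ) (f : MvPowerSeries (Fin 2) ℂ) (k l : ℕ) :
    coeffTX (MvPowerSeries.X 0 ^ i * f) k l = if k < i then 0 else coeffTX f (k - i) l := by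
  induction i generalizing k with
  | zero => simp
  | succ i ih =>
    rw [pow_succ', mul_assoc, coeffTX_X_zero_mul, ih]
    split_ifs <;> first | rfl | omega | (congr 1; omega)

theorem coeffTX_X_one_pow_mul (q : ℕ) (f : MvPowerSeries (Fin 2) ℂ) (k l : ℕ) :
    coeffTX (MvPowerSeries.X 1 ^ q * f) k l = if l < q then 0 else coeffTX f k (l - q) := by
  induction q generalizing l with
  | zero => simp
  | succ i ih =>
    rw [pow_succ', mul_assoc, coeffTX_X_one_mul, ih]
    split_ifs <;> first | rfl | omega | (congr 1; omega)

theorem coeffTX_eulerT (f : MvPowerSeries (Fin 2) ℂ) (k l : ℕ) :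
    coeffTX (eulerT f) k l = k * coeffTX f k l := by
  rw [eulerT, coeffTX_X_zero_mul]
  cases k with
  | zero => simp
  | succ k =>
    rw [if_neg (by omega), coeffTX, MvPowerSeries.coeff_pderiv, coeff_eq_coeffTX]
    simp [mul_comm]

theorem coeffTX_iterate_eulerT (j : ℕ) (f : MvPowerSeries (Fin 2) ℂ) (k l : ℕ) :
    coeffTX (eulerT^[j] f) k l = (k : ℂ) ^ j * coeffTX f k l := by
  induction j with
  | zero => simp
  | succ j ih => rw [Function.iterate_succ_apply', coeffTX_eulerT, ih]; ring

theorem coeffTX_pderiv_one (f : MvPowerSeries (Fin 2) ℂ) (k l : ℕ) :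
    coeffTX (MvPowerSeries.pderiv ℂ 1 f) k l = (l + 1) * coeffTX f k (l + 1) := by
  rw [coeffTX, MvPowerSeries.coeff_pderiv, coeff_eq_coeffTX]
  simp [mul_comm]

theorem coeffTX_iterate_pderiv_one (a : ℕ) (f : MvPowerSeries (Fin 2) ℂ) (k l : ℕ) :
    coeffTX ((MvPowerSeries.pderiv ℂ 1)^[a] f) k l =
      ((l + a).descFactorial a : ℂ) * coeffTX f k (l + a) := by
  induction a generalizing l with
  | zero => simp
  | succ a ih =>
    rw [Function.iterate_succ_apply', coeffTX_pderiv_one, ih, ← add_assoc, Nat.descFactorial_succ,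
      show l + 1 + a = l + a + 1 by ring, show l + a + 1 - a = l + 1 by omega]
    push_cast; ring

theorem coeffTX_jet_inr {m : ℕ} (u : MvPowerSeries (Fin 2) ℂ)
    (q : {q : ℕ × ℕ // q ∈ indexSet m}) (k l : ℕ) :
    coeffTX (jet m u (varZ q)) k l =
      (k : ℂ) ^ q.1.1 * (((l + q.1.2).descFactorial q.1.2 : ℂ) * coeffTX u k (l + q.1.2)) := by
  rw [jet, coeffTX_iterate_eulerT, coeffTX_iterate_pderiv_one]

theorem mem_indexSet {m : ℕ} {q : ℕ × ℕ} : q ∈ indexSet m ↔ q.1 + q.2 ≤ m ∧ q.1 < m := by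
  simp only [indexSet, mem_filter, mem_product, mem_range]; omega

end TotChar

namespace TotChar

open Finset

open scoped Nat

/-! ### The formal Taylor series -/

theorem multinomial_le_card_pow {ι : Type*} [Fintype ι] (n : ι → ℕ) :
    Nat.multinomial univ n ≤ Fintype.card ι ^ (∑ v, n v) := by
  classical
  have h := Finset.sum_pow_eq_sum_piAntidiag (univ : Finset ι) (fun _ => (1 : ℕ)) (∑ v, n v)
  simp only [sum_const, smul_eq_mul, mul_one, one_pow, prod_const_one, card_univ] at h
  rw [h]
  exact Finset.single_le_sum (f := fun k => Nat.multinomial univ k) (fun _ _ => Nat.zero_le _)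
    (by simp)

theorem length_toList_toMultiset {ι : Type*} [Fintype ι] (n : ι →₀ ℕ) :
    n.toMultiset.toList.length = ∑ v, n v := by
  rw [Multiset.length_toList, Finsupp.card_toMultiset, Finsupp.sum_fintype _ _ (fun _ => rfl)]
  rfl

theorem exists_norm_coeff_taylorSeries_le {ι : Type*} [Fintype ι] [DecidableEq ι]
    {F : (ι → ℂ) → ℂ} (hF : AnalyticAt ℂ F 0) :
    ∃ K ρ : ℝ, 0 < K ∧ 0 < ρ ∧
      ∀ n, ‖MvPowerSeries.coeff n (taylorSeries F)‖ ≤ K * ρ ^ (∑ v, n v) := by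
  obtain ⟨p, R, hp⟩ := hF
  obtain ⟨r, hr0, hr⟩ := ENNReal.lt_iff_exists_nnreal_btwn.1 (hp.r_pos.trans_le hp.r_le)
  have hr0 : 0 < r := by exact_mod_cast hr0
  obtain ⟨C, hC, hpC⟩ := p.norm_le_div_pow_of_pos_of_lt_radius hr0 hr
  refine ⟨C, (Fintype.card ι + 1) / r, hC, by positivity, fun n => ?_⟩
  set s := ∑ v, n v with hs
  have hlen := length_toList_toMultiset n
  have hder : ‖iteratedFDeriv ℂ n.toMultiset.toList.length F 0
      (fun i => Pi.single (n.toMultiset.toList.get i) 1)‖ ≤ (s ! : ℝ) * (C / r ^ s) := by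
    rw [hp.iteratedFDeriv_eq_sum_of_completeSpace]
    refine (norm_sum_le_of_le _ (fun σ _ => ((p _).le_opNorm _).trans
      (mul_le_mul (hpC _) (d := ∏ _i : Fin n.toMultiset.toList.length, (1 : ℝ))
      (Finset.prod_le_prod (fun _ _ => norm_nonneg _) fun i _ => ?_)
      (by positivity) (by positivity)))).trans ?_
    · rw [Pi.norm_single, norm_one]
    · simp [hlen, Fintype.card_perm, hs]
  have hfac : (s ! : ℝ) = ((∏ v, (n v)! : ℕ) : ℝ) * Nat.multinomial univ n := by
    rw [← Nat.cast_mul, Nat.multinomial_spec]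
  have hpos : (0 : ℝ) < ((∏ v, (n v)! : ℕ) : ℝ) := by
    exact_mod_cast Finset.prod_pos fun v _ => Nat.factorial_pos _
  have hmul : (Nat.multinomial univ n : ℝ) ≤ (Fintype.card ι + 1 : ℝ) ^ s := by
    refine (Nat.cast_le.2 (multinomial_le_card_pow n)).trans ?_
    rw [Nat.cast_pow]
    gcongr
    linarith
  rw [MvPowerSeries.coeff_apply, taylorSeries, norm_div, Complex.norm_natCast, div_le_iff₀ hpos]
  refine hder.trans ?_
  rw [hfac, div_pow]
  calc _ = Nat.multinomial univ n * (((∏ v, (n v)! : ℕ) : ℝ) * (C / r ^ s)) := by ring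
    _ ≤ (Fintype.card ι + 1 : ℝ) ^ s * (((∏ v, (n v)! : ℕ) : ℝ) * (C / r ^ s)) := by gcongr
    _ = _ := by ring

theorem coeff_taylorSeries_single_eq_zero {ι : Type*} [Fintype ι] [DecidableEq ι]
    {F : (ι → ℂ) → ℂ} (hF : AnalyticAt ℂ F 0) (v : ι)
    (h0 : ∀ᶠ x : ℂ in nhds 0, F (Pi.single v x) = 0) (l : ℕ) :
    MvPowerSeries.coeff (Finsupp.single v l) (taylorSeries F) = 0 := by
  obtain ⟨p, hp⟩ := hF
  let L : ℂ →L[ℂ] (ι → ℂ) := ContinuousLinearMap.toSpanSingleton ℂ (Pi.single v 1)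
  have hL : ∀ x, L x = Pi.single v x := fun x => by
    simp only [L, ContinuousLinearMap.toSpanSingleton_apply]
    rw [← Pi.single_smul', smul_eq_mul, mul_one]
  have hp' : HasFPowerSeriesAt F p (L 0) := by simpa using hp
  have hq := hp'.compContinuousLinearMap (u := L)
  have hz : p.compContinuousLinearMap L = 0 := by
    refine HasFPowerSeriesAt.eq_zero (hq.congr ?_)
    filter_upwards [h0] with x hx
    simp [hL, hx]
  obtain ⟨R, hpR⟩ := hp
  have hget : ∀ i, (Finsupp.single v l).toMultiset.toList.get i = v := fun i => by
    have := List.get_mem (Finsupp.single v l).toMultiset.toList i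
    have h2 := Finsupp.mem_toMultiset _ _ |>.1 (Multiset.mem_toList.1 this)
    exact (Finsupp.mem_support_single _ _ _ |>.1 h2).1
  rw [MvPowerSeries.coeff_apply, taylorSeries, hpR.iteratedFDeriv_eq_sum_of_completeSpace]
  simp only [hget]
  rw [Finset.sum_eq_zero, zero_div]
  intro σ _
  have := congrArg (fun q => q (fun _ => (1 : ℂ)))
    (congrFun hz (Finsupp.single v l).toMultiset.toList.length)
  simp only [FormalMultilinearSeries.compContinuousLinearMap_apply] at this
  simpa [Function.comp_def, hL] using this

end TotChar

namespace TotChar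

open Finset

/-! ### Substitution of a jet -/

/-- The series `u / t`, for `u` without terms of order `0` in `t`. -/
noncomputable def shiftT (u : MvPowerSeries (Fin 2) ℂ) : MvPowerSeries (Fin 2) ℂ :=
  ofCoeff fun k l => coeffTX u (k + 1) l

theorem X_zero_mul_shiftT {u : MvPowerSeries (Fin 2) ℂ} (hu : ∀ l, coeffTX u 0 l = 0) :
    MvPowerSeries.X 0 * shiftT u = u := by
  refine ext_coeffTX fun k l => ?_
  rw [coeffTX_X_zero_mul, shiftT, coeffTX_ofCoeff]
  cases k with
  | zero => simp [hu]
  | succ k => simp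

/-- The total degree of a monomial in the variables `z_{j,α}`. -/
def zDegree {m : ℕ} (n : Var m → ℕ) : ℕ := ∑ q, n (varZ q)

/-- The product `∏ ((t ∂_t)^j ∂_x^α u / t)^{ν_{j,α}}`. -/
noncomputable def zMonomial {m : ℕ} (u : MvPowerSeries (Fin 2) ℂ) (n : Var m → ℕ) :
    MvPowerSeries (Fin 2) ℂ :=
  ∏ q, shiftT (jet m u (varZ q)) ^ n (varZ q)

theorem coeffTX_jet_inr_zero {m : ℕ} {u : MvPowerSeries (Fin 2) ℂ}
    (hu : ∀ l, coeffTX u 0 l = 0) (q : {q : ℕ × ℕ // q ∈ indexSet m}) (l : ℕ) :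
    coeffTX (jet m u (varZ q)) 0 l = 0 := by
  rw [coeffTX_jet_inr, hu]; simp

theorem prod_jet_pow {m : ℕ} {u : MvPowerSeries (Fin 2) ℂ} (hu : ∀ l, coeffTX u 0 l = 0)
    (n : Var m → ℕ) :
    ∏ v, jet m u v ^ n v = MvPowerSeries.X 0 ^ (n (varT m) + zDegree n) *
      (MvPowerSeries.X 1 ^ n (varX m) * zMonomial u n) := by
  have h : ∀ q, jet m u (Sum.inr q) ^ n (Sum.inr q) = MvPowerSeries.X 0 ^ n (Sum.inr q) *
      shiftT (jet m u (varZ q)) ^ n (Sum.inr q) := fun q => by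
    rw [← mul_pow, X_zero_mul_shiftT (coeffTX_jet_inr_zero hu q)]
  rw [Fintype.prod_sum_type, Fin.prod_univ_two, Finset.prod_congr rfl (fun q _ => h q),
    Finset.prod_mul_distrib, Finset.prod_pow_eq_pow_sum, zMonomial, zDegree, pow_add]
  simp only [jet]
  ring

theorem coeffTX_prod_jet_pow {m : ℕ} {u : MvPowerSeries (Fin 2) ℂ}
    (hu : ∀ l, coeffTX u 0 l = 0) (n : Var m → ℕ) (k l : ℕ) :
    coeffTX (∏ v, jet m u v ^ n v) k l =
      if k < n (varT m) + zDegree n then 0 else if l < n (varX m) then 0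
      else coeffTX (zMonomial u n) (k - (n (varT m) + zDegree n)) (l - n (varX m)) := by
  rw [prod_jet_pow hu, coeffTX_X_zero_pow_mul, coeffTX_X_one_pow_mul]

/-- The exponents at most `N` in each variable. -/
def box (m N : ℕ) : Finset (Var m → ℕ) := Fintype.piFinset fun _ => range (N + 1)

theorem mem_box {m N : ℕ} {n : Var m → ℕ} : n ∈ box m N ↔ ∀ v, n v ≤ N := by
  simp [box, Fintype.mem_piFinset]

/-- The Taylor coefficients of `F` at the origin. -/
noncomputable def taylorCoeff {m : ℕ} (F : (Var m → ℂ) → ℂ) (n : Var m → ℕ) : ℂ :=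
  MvPowerSeries.coeff (Finsupp.equivFunOnFinite.symm n) (taylorSeries F)

theorem hasSubst_jet {m : ℕ} {u : MvPowerSeries (Fin 2) ℂ} (hu : ∀ l, coeffTX u 0 l = 0) :
    MvPowerSeries.HasSubst (jet m u) := by
  refine MvPowerSeries.hasSubst_of_constantCoeff_zero fun v => ?_
  rcases v with i | q
  · simp [jet]
  · have := coeffTX_jet_inr_zero hu q 0
    simpa [coeffTX] using this

theorem coeffTX_prod_jet_pow_eq_zero {m : ℕ} {u : MvPowerSeries (Fin 2) ℂ}
    (hu : ∀ l, coeffTX u 0 l = 0) {n : Var m → ℕ} {k l N : ℕ} (hN : k + l ≤ N)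
    (hn : n ∉ box m N) : coeffTX (∏ v, jet m u v ^ n v) k l = 0 := by
  rw [coeffTX_prod_jet_pow hu]
  rw [mem_box] at hn
  push Not at hn
  obtain ⟨v, hv⟩ := hn
  split_ifs with h1 h2
  · rfl
  · rfl
  · exfalso
    rcases v with i | q
    · fin_cases i
      · change N < n (varT m) at hv; omega
      · change N < n (varX m) at hv; omega
    · have : n (varZ q) ≤ zDegree n :=
        Finset.single_le_sum (f := fun q => n (varZ q)) (fun _ _ => Nat.zero_le _) (mem_univ q)
      change N < n (varZ q) at hv
      omega

theorem coeffTX_subst_jet {m : ℕ} (F : (Var m → ℂ) → ℂ) {u : MvPowerSeries (Fin 2) ℂ}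
    (hu : ∀ l, coeffTX u 0 l = 0) {k l N : ℕ} (hN : k + l ≤ N) :
    coeffTX (MvPowerSeries.subst (jet m u) (taylorSeries F)) k l =
      ∑ n ∈ box m N, taylorCoeff F n * coeffTX (∏ v, jet m u v ^ n v) k l := by
  rw [coeffTX, MvPowerSeries.coeff_subst (hasSubst_jet hu),
    ← finsum_comp_equiv (Finsupp.equivFunOnFinite : (Var m →₀ ℕ) ≃ (Var m → ℕ)).symm]
  have h : ∀ n : Var m → ℕ, (Finsupp.equivFunOnFinite.symm n).prod (fun s e => jet m u s ^ e) =
      ∏ v, jet m u v ^ n v := fun n => by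
    rw [Finsupp.prod_fintype _ _ (fun _ => pow_zero _)]; rfl
  simp only [h, smul_eq_mul]
  refine finsum_eq_sum_of_support_subset _ fun n hn => ?_
  by_contra hb
  exact hn (by
    have := coeffTX_prod_jet_pow_eq_zero hu hN (fun h => hb (Finset.mem_coe.2 h))
    rw [coeffTX] at this
    simp only [this, mul_zero])

/-! ### The linear and the nonlinear part -/

/-- A monomial which is not of the form `x^p` or `x^p z_{j,α}`. -/
def IsRest {m : ℕ} (n : Var m → ℕ) : Prop := 1 ≤ n (varT m) ∨ 2 ≤ zDegree n

instance {m : ℕ} : DecidablePred (IsRest (m := m)) := fun n =>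
  inferInstanceAs (Decidable (1 ≤ n (varT m) ∨ 2 ≤ zDegree n))

/-- The coefficient of `t^k x^l` in the sum of the terms of `F(t, x, z)` other than the linear
terms in `z`, with the jet of `u` substituted for `z`. -/
noncomputable def rest {m : ℕ} (F : (Var m → ℂ) → ℂ) (u : MvPowerSeries (Fin 2) ℂ) (k l : ℕ) :
    ℂ :=
  ∑ n ∈ (box m (k + l)).filter IsRest, taylorCoeff F n * coeffTX (∏ v, jet m u v ^ n v) k l

/-- The exponent of `x^p z_{j,α}`. -/
def linExponent {m : ℕ} (q : {q : ℕ × ℕ // q ∈ indexSet m}) (p : ℕ) : Var m → ℕ :=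
  Pi.single (varX m) p + Pi.single (varZ q) 1

theorem linExponent_varT {m : ℕ} (q : {q : ℕ × ℕ // q ∈ indexSet m}) (p : ℕ) :
    linExponent q p (varT m) = 0 := by
  simp [linExponent]

theorem linExponent_varX {m : ℕ} (q : {q : ℕ × ℕ // q ∈ indexSet m}) (p : ℕ) :
    linExponent q p (varX m) = p := by
  simp [linExponent]

theorem linExponent_varZ {m : ℕ} (q q' : {q : ℕ × ℕ // q ∈ indexSet m}) (p : ℕ) :
    linExponent q p (varZ q') = if q' = q then 1 else 0 := by
  simp [linExponent, Pi.single_apply]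

theorem zDegree_linExponent {m : ℕ} (q : {q : ℕ × ℕ // q ∈ indexSet m}) (p : ℕ) :
    zDegree (linExponent q p) = 1 := by
  simp [zDegree, linExponent_varZ]

theorem eq_linExponent {m : ℕ} {n : Var m → ℕ} (h0 : n (varT m) = 0) (h1 : zDegree n = 1) :
    ∃ q, n = linExponent q (n (varX m)) := by
  obtain ⟨q, -, hq⟩ := Finset.exists_ne_zero_of_sum_ne_zero (h1.trans_ne one_ne_zero)
  have hsum := Finset.add_sum_erase univ (fun q => n (varZ q)) (mem_univ q)
  change _ = zDegree n at hsum
  refine ⟨q, funext fun v => ?_⟩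
  rcases v with i | q'
  · fin_cases i
    · exact h0.trans (linExponent_varT _ _).symm
    · exact (linExponent_varX _ _).symm
  · change n (varZ q') = linExponent q _ (varZ q')
    rw [linExponent_varZ]
    split_ifs with hqq
    · subst hqq; omega
    · have : n (varZ q') ≤ ∑ q ∈ univ.erase q, n (varZ q) :=
        Finset.single_le_sum (f := fun q => n (varZ q)) (fun _ _ => Nat.zero_le _)
          (by simp [hqq])
      omega

theorem zMonomial_linExponent {m : ℕ} (u : MvPowerSeries (Fin 2) ℂ)
    (q : {q : ℕ × ℕ // q ∈ indexSet m}) (p : ℕ) :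
    zMonomial u (linExponent q p) = shiftT (jet m u (varZ q)) := by
  rw [zMonomial, Finset.prod_eq_single q]
  · simp [linExponent_varZ]
  · intro q' _ h; simp [linExponent_varZ, h]
  · simp

theorem taylorCoeff_linExponent {m : ℕ} (F : (Var m → ℂ) → ℂ)
    (q : {q : ℕ × ℕ // q ∈ indexSet m}) (p : ℕ) :
    taylorCoeff F (linExponent q p) = PowerSeries.coeff p (coeffB F q) := by
  rw [taylorCoeff, coeffB, PowerSeries.coeff_mk]
  congr 2
  ext v
  simp [linExponent, Finsupp.single_apply, Pi.single_apply, eq_comm]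

theorem sum_filter_not_isRest {m : ℕ} {N : ℕ} (hN : 1 ≤ N) (g : (Var m → ℕ) → ℂ)
    (hg : ∀ n, n (varT m) = 0 → zDegree n = 0 → g n = 0) :
    ∑ n ∈ (box m N).filter (fun n => ¬ IsRest n), g n =
      ∑ q, ∑ p ∈ range (N + 1), g (linExponent q p) := by
  rw [← Finset.sum_product', eq_comm]
  refine Finset.sum_bij_ne_zero (fun a _ _ => linExponent a.1 a.2) ?_ ?_ ?_ ?_
  · rintro ⟨q, p⟩ ha -
    simp only [mem_product, mem_univ, true_and, mem_range] at ha
    rw [mem_filter, mem_box, IsRest, linExponent_varT, zDegree_linExponent]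
    refine ⟨fun v => ?_, by omega⟩
    rcases v with i | q'
    · fin_cases i
      · change linExponent q p (varT m) ≤ N
        rw [linExponent_varT]; omega
      · change linExponent q p (varX m) ≤ N
        rw [linExponent_varX]; omega
    · change linExponent q p (varZ q') ≤ N
      rw [linExponent_varZ]; split_ifs <;> omega
  · rintro ⟨q, p⟩ _ _ ⟨q', p'⟩ _ _ h
    have hp : p = p' := by
      have := congrFun h (varX m)
      simpa only [linExponent_varX] using this
    have hq := congrFun h (varZ q)
    rw [linExponent_varZ, linExponent_varZ, if_pos rfl] at hq
    split_ifs at hq with hqq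
    · rw [hqq, hp]
  · intro n hn hgn
    rw [mem_filter, mem_box, IsRest, not_or, not_le, not_le] at hn
    have h0 : n (varT m) = 0 := by omega
    have h1 : zDegree n = 1 := by
      have : zDegree n ≠ 0 := fun h => hgn (hg n h0 h)
      omega
    obtain ⟨q, hq⟩ := eq_linExponent h0 h1
    refine ⟨(q, n (varX m)), ?_, ?_, hq.symm⟩
    · simp only [mem_product, mem_univ, true_and, mem_range]
      have := hn.1 (varX m); omega
    · rwa [← hq]
  · intro a _ _; rfl

theorem coeff_coeffC {m : ℕ} (F : (Var m → ℂ) → ℂ) (q : {q : ℕ × ℕ // q ∈ indexSet m}) (p : ℕ) :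
    PowerSeries.coeff p (coeffC F q.1) = PowerSeries.coeff (p + q.1.2) (coeffB F q) := by
  rw [coeffC, dif_pos q.2, PowerSeries.coeff_mk]

theorem coeff_coeffB_eq_zero {m : ℕ} {F : (Var m → ℂ) → ℂ} (hF : TotallyCharacteristic F)
    (q : {q : ℕ × ℕ // q ∈ indexSet m}) {p : ℕ} (hp : p < q.1.2) :
    PowerSeries.coeff p (coeffB F q) = 0 :=
  PowerSeries.X_pow_dvd_iff.1 (hF q (by omega)) p hp

/-- The contribution of the linear terms in `z` to the coefficient of `t^k x^l`. -/
noncomputable def linTerm {m : ℕ} (F : (Var m → ℂ) → ℂ) (u : MvPowerSeries (Fin 2) ℂ)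
    (k l : ℕ) (q : ℕ × ℕ) (p : ℕ) : ℂ :=
  PowerSeries.coeff p (coeffC F q) *
    ((k : ℂ) ^ q.1 * (((l - p).descFactorial q.2 : ℂ) * coeffTX u k (l - p)))

theorem sum_coeffB_eq_sum_linTerm {m : ℕ} {F : (Var m → ℂ) → ℂ} (hF : TotallyCharacteristic F)
    {u : MvPowerSeries (Fin 2) ℂ} (hu : ∀ l, coeffTX u 0 l = 0)
    (q : {q : ℕ × ℕ // q ∈ indexSet m}) {k : ℕ} (hk : 1 ≤ k) (l N : ℕ) (hN : l ≤ N) :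
    ∑ p ∈ range (N + 1), taylorCoeff F (linExponent q p) *
      coeffTX (∏ v, jet m u v ^ linExponent q p v) k l =
    ∑ p ∈ range (l + 1), linTerm F u k l q.1 p := by
  symm
  refine Finset.sum_bij_ne_zero (fun p _ _ => p + q.1.2) ?_ ?_ ?_ ?_
  · intro p hp hne
    rw [mem_range] at hp ⊢
    have : ¬ (l - p < q.1.2) := fun h => hne (by
      rw [linTerm, Nat.descFactorial_of_lt h]; simp)
    omega
  · intro a _ _ b _ _ h; omega
  · intro p hp hne
    rw [taylorCoeff_linExponent, coeffTX_prod_jet_pow hu, linExponent_varT, linExponent_varX,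
      zDegree_linExponent, zMonomial_linExponent, if_neg (by omega)] at hne
    have h1 : ¬ p < q.1.2 := fun h => hne (by rw [coeff_coeffB_eq_zero hF q h, zero_mul])
    have h2 : ¬ l < p := fun h => hne (by rw [if_pos h, mul_zero])
    rw [if_neg h2, shiftT, coeffTX_ofCoeff, coeffTX_jet_inr] at hne
    refine ⟨p - q.1.2, by rw [mem_range]; omega, ?_, by omega⟩
    rw [linTerm, coeff_coeffC]
    have e1 : p - q.1.2 + q.1.2 = p := by omega
    have e2 : l - (p - q.1.2) = l - p + q.1.2 := by omega
    have e3 : k - (0 + 1) + 1 = k := by omega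
    rw [e1, e2]
    rwa [e3] at hne
  · intro p hp hne
    rw [mem_range] at hp
    have : ¬ (l - p < q.1.2) := fun h => hne (by
      rw [linTerm, Nat.descFactorial_of_lt h]; simp)
    rw [taylorCoeff_linExponent, coeffTX_prod_jet_pow hu, linExponent_varT, linExponent_varX,
      zDegree_linExponent, zMonomial_linExponent, if_neg (by omega), if_neg (by omega), shiftT,
      coeffTX_ofCoeff, coeffTX_jet_inr, linTerm, coeff_coeffC]
    have e2 : l - (p + q.1.2) + q.1.2 = l - p := by omega
    have e3 : k - (0 + 1) + 1 = k := by omega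
    rw [e2, e3]

theorem coeffTX_subst_jet_eq {m : ℕ} {F : (Var m → ℂ) → ℂ} (hF : TotallyCharacteristic F)
    (h0 : ∀ l, MvPowerSeries.coeff (Finsupp.single (varX m) l) (taylorSeries F) = 0)
    {u : MvPowerSeries (Fin 2) ℂ} (hu : ∀ l, coeffTX u 0 l = 0) {k : ℕ} (hk : 1 ≤ k) (l : ℕ) :
    coeffTX (MvPowerSeries.subst (jet m u) (taylorSeries F)) k l =
      (∑ q ∈ indexSet m, ∑ p ∈ range (l + 1), linTerm F u k l q p) + rest F u k l := by
  rw [coeffTX_subst_jet F hu le_rfl, ← Finset.sum_filter_add_sum_filter_not _ IsRest,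
    sum_filter_not_isRest (by omega), add_comm, rest]
  · congr 1
    rw [Finset.sum_congr rfl fun q _ =>
      sum_coeffB_eq_sum_linTerm hF hu q hk l (k + l) (by omega)]
    exact Finset.sum_coe_sort (indexSet m) fun q => ∑ p ∈ range (l + 1), linTerm F u k l q p
  · intro n hnT hnz
    have hn : Finsupp.equivFunOnFinite.symm n = Finsupp.single (varX m) (n (varX m)) := by
      ext v
      rcases v with i | q
      · fin_cases i
        · simpa [Finsupp.single_apply] using hnT
        · simp
      · have : n (varZ q) = 0 := Finset.sum_eq_zero_iff.1 hnz q (mem_univ q)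
        simpa [Finsupp.single_apply] using this
    rw [taylorCoeff, hn, h0, zero_mul]

end TotChar

namespace TotChar

open Finset

/-! ### Existence and uniqueness of the formal solution -/

/-- Two series agree up to order `N` in `t`. -/
def AgreeT (N : ℕ) (f g : MvPowerSeries (Fin 2) ℂ) : Prop :=
  ∀ k < N, ∀ l, coeffTX f k l = coeffTX g k l

theorem AgreeT.mul {N : ℕ} {f g f' g' : MvPowerSeries (Fin 2) ℂ} (h : AgreeT N f g)
    (h' : AgreeT N f' g') : AgreeT N (f * f') (g * g') := fun k hk l => by
  rw [coeffTX_mul, coeffTX_mul]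
  refine Finset.sum_congr rfl fun a ha => Finset.sum_congr rfl fun b _ => ?_
  have := HasAntidiagonal.mem_antidiagonal.1 ha
  rw [h _ (by omega), h' _ (by omega)]

theorem AgreeT.pow {N : ℕ} {f g : MvPowerSeries (Fin 2) ℂ} (h : AgreeT N f g) (i : ℕ) :
    AgreeT N (f ^ i) (g ^ i) := by
  induction i with
  | zero => intro k _ l; simp
  | succ i ih => rw [pow_succ, pow_succ]; exact ih.mul h

theorem AgreeT.prod {ι : Type*} (s : Finset ι) {N : ℕ} {f g : ι → MvPowerSeries (Fin 2) ℂ}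
    (h : ∀ i ∈ s, AgreeT N (f i) (g i)) : AgreeT N (∏ i ∈ s, f i) (∏ i ∈ s, g i) := by
  classical
  induction s using Finset.induction_on with
  | empty => intro k _ l; simp
  | insert a s ha ih =>
    rw [Finset.prod_insert ha, Finset.prod_insert ha]
    exact (h a (by simp)).mul (ih fun i hi => h i (by simp [hi]))

theorem rest_congr {m : ℕ} (F : (Var m → ℂ) → ℂ) {u v : MvPowerSeries (Fin 2) ℂ}
    (hu : ∀ l, coeffTX u 0 l = 0) (hv : ∀ l, coeffTX v 0 l = 0) {k : ℕ}
    (h : AgreeT k u v) (l : ℕ) : rest F u k l = rest F v k l := by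
  refine Finset.sum_congr rfl fun n hn => ?_
  have hn := (mem_filter.1 hn).2
  congr 1
  rw [coeffTX_prod_jet_pow hu, coeffTX_prod_jet_pow hv]
  split_ifs with h1 h2
  · rfl
  · rfl
  · have hz : AgreeT (k - 1) (zMonomial u n) (zMonomial v n) := by
      refine AgreeT.prod _ fun q _ => AgreeT.pow (fun k' hk' l' => ?_) _
      simp only [shiftT, coeffTX_ofCoeff, coeffTX_jet_inr]
      rw [h _ (by omega)]
    by_cases h3 : zDegree n = 0
    · have h4 : ∀ q, n (varZ q) = 0 := fun q => Finset.sum_eq_zero_iff.1 h3 q (mem_univ q)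
      simp [zMonomial, h4]
    · refine hz _ ?_ _
      rcases hn with hn | hn <;> omega

/-- The right hand side of the recursion for the coefficients of the formal solution. -/
noncomputable def recursionRHS {m : ℕ} (F : (Var m → ℂ) → ℂ) (u : MvPowerSeries (Fin 2) ℂ)
    (k l : ℕ) : ℂ :=
  (∑ q ∈ indexSet m, ∑ p ∈ Ico 1 (l + 1), linTerm F u k l q p) + rest F u k l

theorem recursionRHS_congr {m : ℕ} (F : (Var m → ℂ) → ℂ) {u v : MvPowerSeries (Fin 2) ℂ}
    (hu : ∀ l, coeffTX u 0 l = 0) (hv : ∀ l, coeffTX v 0 l = 0) {k l : ℕ}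
    (h : AgreeT k u v) (h' : ∀ l' < l, coeffTX u k l' = coeffTX v k l') :
    recursionRHS F u k l = recursionRHS F v k l := by
  rw [recursionRHS, recursionRHS, rest_congr F hu hv h]
  congr 1
  refine Finset.sum_congr rfl fun q _ => Finset.sum_congr rfl fun p hp => ?_
  rw [mem_Ico] at hp
  rw [linTerm, linTerm, h' _ (by omega)]

theorem prod_range_sub_natCast (l a : ℕ) :
    ∏ i ∈ range a, ((l : ℂ) - (i : ℂ)) = (l.descFactorial a : ℂ) := by
  rw [← descPochhammer_eval_eq_prod_range, descPochhammer_eval_eq_descFactorial]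

theorem coeffTX_subst_jet_zero {m : ℕ} {F : (Var m → ℂ) → ℂ}
    (h0 : ∀ l, MvPowerSeries.coeff (Finsupp.single (varX m) l) (taylorSeries F) = 0)
    {u : MvPowerSeries (Fin 2) ℂ} (hu : ∀ l, coeffTX u 0 l = 0) (l : ℕ) :
    coeffTX (MvPowerSeries.subst (jet m u) (taylorSeries F)) 0 l = 0 := by
  rw [coeffTX_subst_jet F hu le_rfl]
  refine Finset.sum_eq_zero fun n _ => ?_
  rw [coeffTX_prod_jet_pow hu]
  split_ifs with h1 h2
  · simp
  · simp
  · have hn : Finsupp.equivFunOnFinite.symm n = Finsupp.single (varX m) (n (varX m)) := by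
      ext v
      rcases v with i | q
      · fin_cases i
        · have : n (varT m) = 0 := by omega
          simpa [Finsupp.single_apply] using this
        · simp
      · have hz : zDegree n = 0 := by omega
        have : n (varZ q) = 0 := Finset.sum_eq_zero_iff.1 hz q (mem_univ q)
        simpa [Finsupp.single_apply] using this
    rw [taylorCoeff, hn, h0, zero_mul]

theorem isFormalSolution_iff {m : ℕ} {F : (Var m → ℂ) → ℂ}
    (hF : TotallyCharacteristic F)
    (h0 : ∀ l, MvPowerSeries.coeff (Finsupp.single (varX m) l) (taylorSeries F) = 0)
    (u : MvPowerSeries (Fin 2) ℂ) :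
    IsFormalSolution F u ↔ (∀ l, coeffTX u 0 l = 0) ∧
      ∀ k l : ℕ, 1 ≤ k → indicial F k l * coeffTX u k l = recursionRHS F u k l := by
  have key : (∀ l, coeffTX u 0 l = 0) → ∀ k l : ℕ, 1 ≤ k →
      (coeffTX (eulerT^[m] u) k l =
        coeffTX (MvPowerSeries.subst (jet m u) (taylorSeries F)) k l ↔
      indicial F k l * coeffTX u k l = recursionRHS F u k l) := by
    intro hu k l hk
    rw [coeffTX_subst_jet_eq hF h0 hu hk, coeffTX_iterate_eulerT, recursionRHS, indicial]
    have : ∀ q ∈ indexSet m, ∑ p ∈ range (l + 1), linTerm F u k l q p =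
        coeffC0 F q * (k : ℂ) ^ q.1 * (∏ i ∈ range q.2, ((l : ℂ) - (i : ℂ))) * coeffTX u k l +
          ∑ p ∈ Ico 1 (l + 1), linTerm F u k l q p := fun q _ => by
      rw [Finset.range_eq_Ico, Finset.sum_eq_sum_Ico_succ_bot (by omega), prod_range_sub_natCast,
        linTerm, coeffC0, Nat.sub_zero, PowerSeries.coeff_zero_eq_constantCoeff]
      ring
    rw [Finset.sum_congr rfl this, Finset.sum_add_distrib, sub_mul, Finset.sum_mul,
      sub_eq_iff_eq_add']
    constructor <;> intro h <;> rw [h] <;> ring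
  constructor
  · intro hs
    have hu : ∀ l, coeffTX u 0 l = 0 := fun l => hs.zero_at_t_zero _ (by simp)
    exact ⟨hu, fun k l hk => (key hu k l hk).1 (by rw [hs.equation])⟩
  · rintro ⟨hu, h⟩
    refine ⟨fun n hn => by rw [coeff_eq_coeffTX, hn, hu], ext_coeffTX fun k l => ?_⟩
    rcases Nat.eq_zero_or_pos k with rfl | hk
    · rw [coeffTX_subst_jet_zero h0 hu, coeffTX_iterate_eulerT, hu, mul_zero]
    · exact (key hu k l hk).2 (h k l hk)

theorem exists_recursion {m : ℕ} (F : (Var m → ℂ) → ℂ) (hN : NonResonance F) :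
    ∃ u : MvPowerSeries (Fin 2) ℂ, (∀ l, coeffTX u 0 l = 0) ∧
      ∀ k l : ℕ, 1 ≤ k → indicial F k l * coeffTX u k l = recursionRHS F u k l := by
  classical
  have wf : WellFounded (fun a b : ℕ ×ₗ ℕ => a < b) := wellFounded_lt
  let step : (p : ℕ ×ₗ ℕ) → ((p' : ℕ ×ₗ ℕ) → p' < p → ℂ) → ℂ := fun p w =>
    if (ofLex p).1 = 0 then 0 else
      recursionRHS F (ofCoeff fun k' l' =>
        if h : toLex (k', l') < p then w (toLex (k', l')) h else 0) (ofLex p).1 (ofLex p).2 /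
        indicial F (ofLex p).1 (ofLex p).2
  let c : ℕ ×ₗ ℕ → ℂ := wf.fix step
  have hc : ∀ p, c p = step p fun p' _ => c p' := fun p => wf.fix_eq step p
  have hc0 : ∀ l, c (toLex (0, l)) = 0 := fun l => by rw [hc]; simp [step]
  refine ⟨ofCoeff fun k l => c (toLex (k, l)), fun l => by rw [coeffTX_ofCoeff, hc0], ?_⟩
  intro k l hk
  rw [coeffTX_ofCoeff, hc]
  simp only [step, ofLex_toLex]
  rw [if_neg (by omega), mul_div_cancel₀ _ (hN k l hk)]
  apply recursionRHS_congr
  · intro l'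
    rw [coeffTX_ofCoeff]
    split_ifs
    · exact hc0 l'
    · rfl
  · intro l'; rw [coeffTX_ofCoeff, hc0]
  · intro k' hk' l'
    rw [coeffTX_ofCoeff, coeffTX_ofCoeff, dif_pos]
    exact Prod.Lex.toLex_lt_toLex.2 (Or.inl hk')
  · intro l' hl'
    rw [coeffTX_ofCoeff, coeffTX_ofCoeff, dif_pos]
    exact Prod.Lex.toLex_lt_toLex.2 (Or.inr ⟨rfl, hl'⟩)

theorem recursion_unique {m : ℕ} {F : (Var m → ℂ) → ℂ} (hN : NonResonance F)
    {u v : MvPowerSeries (Fin 2) ℂ} (hu : ∀ l, coeffTX u 0 l = 0)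
    (hv : ∀ l, coeffTX v 0 l = 0)
    (hu' : ∀ k l : ℕ, 1 ≤ k → indicial F k l * coeffTX u k l = recursionRHS F u k l)
    (hv' : ∀ k l : ℕ, 1 ≤ k → indicial F k l * coeffTX v k l = recursionRHS F v k l) : u = v := by
  refine ext_coeffTX fun k => ?_
  induction k using Nat.strong_induction_on with
  | _ k ihk =>
    intro l
    induction l using Nat.strong_induction_on with
    | _ l ihl =>
      rcases Nat.eq_zero_or_pos k with rfl | hk
      · rw [hu, hv]
      · refine mul_left_cancel₀ (hN k l hk) ?_
        rw [hu' k l hk, hv' k l hk]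
        exact recursionRHS_congr F hu hv ihk ihl

end TotChar

namespace TotChar

open Finset Filter Topology

/-! ### The Newton polygon and the indicial polynomial -/

theorem coeffC0_top {m : ℕ} (F : (Var m → ℂ) → ℂ) : coeffC0 F (m, 0) = -1 := by
  rw [coeffC0, coeffC, dif_neg (by rw [mem_indexSet]; simp), if_pos rfl, map_neg, map_one]

theorem mem_lambda0 {m : ℕ} {F : (Var m → ℂ) → ℂ} {q : ℕ × ℕ} :
    q ∈ lambda0 F ↔ q = (m, 0) ∨ (q ∈ indexSet m ∧ coeffC0 F q ≠ 0) := by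
  simp [lambda0]

theorem coeffC0_ne_zero {m : ℕ} {F : (Var m → ℂ) → ℂ} {q : ℕ × ℕ} (hq : q ∈ lambda0 F) :
    coeffC0 F q ≠ 0 := by
  rcases mem_lambda0.1 hq with rfl | h
  · rw [coeffC0_top]; simp
  · exact h.2

theorem top_mem_lambda0 {m : ℕ} (F : (Var m → ℂ) → ℂ) : (m, 0) ∈ lambda0 F :=
  mem_lambda0.2 (Or.inl rfl)

theorem indicial_eq_neg_sum {m : ℕ} (F : (Var m → ℂ) → ℂ) (k l : ℕ) :
    indicial F k l = -∑ q ∈ lambda0 F,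
      coeffC0 F q * ((k : ℂ) ^ q.1 * (l.descFactorial q.2 : ℂ)) := by
  classical
  rw [lambda0, Finset.sum_union, Finset.sum_singleton, coeffC0_top, indicial, Finset.sum_filter]
  · have : ∀ q ∈ indexSet m, coeffC0 F q * (k : ℂ) ^ q.1 *
        ∏ i ∈ range q.2, ((l : ℂ) - (i : ℂ)) =
        if coeffC0 F q ≠ 0 then coeffC0 F q * ((k : ℂ) ^ q.1 * (l.descFactorial q.2 : ℂ))
        else 0 := fun q _ => by
      rw [prod_range_sub_natCast]
      split_ifs with h
      · ring
      · rw [not_not.1 h]; ring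
    rw [Finset.sum_congr rfl this]
    simp
    ring
  · rw [Finset.disjoint_singleton_left, mem_filter, mem_indexSet]
    simp

theorem toPlane_mem_newtonPolygon {m : ℕ} {F : (Var m → ℂ) → ℂ} {q : ℕ × ℕ}
    (hq : q ∈ lambda0 F) {P : ℝ × ℝ} (hP : P ≤ toPlane q) : P ∈ newtonPolygon F :=
  subset_convexHull ℝ _ (Set.mem_biUnion hq hP)

theorem le_of_mem_newtonPolygon {m : ℕ} {F : (Var m → ℂ) → ℂ} {a b c : ℝ} (ha : 0 ≤ a)
    (hb : 0 ≤ b) (h : ∀ q ∈ lambda0 F, a * q.1 + b * q.2 ≤ c) {P : ℝ × ℝ}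
    (hP : P ∈ newtonPolygon F) : a * P.1 + b * P.2 ≤ c := by
  have hlin : IsLinearMap ℝ fun P : ℝ × ℝ => a * P.1 + b * P.2 :=
    ⟨fun x y => by simp only [Prod.fst_add, Prod.snd_add]; ring,
      fun t x => by simp only [Prod.smul_fst, Prod.smul_snd, smul_eq_mul]; ring⟩
  refine convexHull_min ?_ (convex_halfSpace_le hlin c) hP
  refine Set.iUnion₂_subset fun q hq P hP => ?_
  have h1 : P.1 ≤ q.1 := hP.1
  have h2 : P.2 ≤ q.2 := hP.2
  refine le_trans ?_ (h q hq)
  gcongr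

theorem mem_lambda0Face {m : ℕ} {F : (Var m → ℂ) → ℂ} {s : ℝ} (hs : 0 ≤ s) {q : ℕ × ℕ} :
    q ∈ lambda0Face F s ↔ q ∈ lambda0 F ∧
      ∀ q' ∈ lambda0 F, s * q'.1 + q'.2 ≤ s * q.1 + q.2 := by
  classical
  rw [lambda0Face, mem_filter, face]
  refine and_congr_right fun hq => ⟨fun h q' hq' => ?_, fun h => ?_⟩
  · exact h.2 (toPlane q') (toPlane_mem_newtonPolygon hq' le_rfl)
  · refine ⟨toPlane_mem_newtonPolygon hq le_rfl, fun Q hQ => ?_⟩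
    have := le_of_mem_newtonPolygon (b := 1) (c := s * q.1 + q.2) hs zero_le_one
      (by simpa using h) hQ
    simpa [toPlane] using this

theorem tendsto_descFactorial_div_pow (a : ℕ) :
    Tendsto (fun l : ℕ => (l.descFactorial a : ℝ) / (l : ℝ) ^ a) atTop (𝓝 1) := by
  induction a with
  | zero => simp
  | succ a ih =>
    have h : Tendsto (fun l : ℕ => 1 - (a : ℝ) / (l : ℝ)) atTop (𝓝 (1 - 0)) :=
      tendsto_const_nhds.sub (tendsto_const_div_atTop_nhds_zero_nat (a : ℝ))
    have := h.mul ih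
    rw [sub_zero, mul_one] at this
    refine this.congr' ?_
    filter_upwards [eventually_gt_atTop a] with l hl
    have hl0 : (l : ℝ) ≠ 0 := Nat.cast_ne_zero.2 (by omega)
    rw [Nat.descFactorial_succ, Nat.cast_mul, Nat.cast_sub hl.le]
    field_simp
    ring

/-- An exponential sum over a face of the Newton polygon. -/
noncomputable def faceSum {m : ℕ} (F : (Var m → ℂ) → ℂ) (s η : ℝ) : ℂ :=
  ∑ q ∈ lambda0Face F s, coeffC0 F q * ((Real.exp η : ℝ) : ℂ) ^ q.1

theorem faceSum_ne_zero {m : ℕ} {F : (Var m → ℂ) → ℂ} (hGP : GeneralizedPoincare F) {s : ℝ}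
    (hs : IsEdgeSlope F s) (η : ℝ) : faceSum F s η ≠ 0 := by
  intro h0
  have h1 : ((Real.exp η : ℝ) : ℂ) ^ leftEnd F s *
      (charPoly F s).eval ((Real.exp η : ℝ) : ℂ) = faceSum F s η := by
    rw [charPoly, Polynomial.eval_finsetSum, Finset.mul_sum, faceSum]
    refine Finset.sum_congr rfl fun q hq => ?_
    have : leftEnd F s ≤ q.1 := Nat.sInf_le ⟨q, hq, rfl⟩
    simp only [Polynomial.eval_mul, Polynomial.eval_C, Polynomial.eval_pow, Polynomial.eval_X]
    rw [mul_left_comm, ← pow_add, Nat.add_sub_cancel' this]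
  have h2 : ((Real.exp η : ℝ) : ℂ) ^ leftEnd F s ≠ 0 :=
    pow_ne_zero _ (Complex.ofReal_ne_zero.2 (Real.exp_pos _).ne')
  have h3 : (charPoly F s).eval ((Real.exp η : ℝ) : ℂ) = 0 :=
    (mul_eq_zero.1 (h1.trans h0)).resolve_left h2
  exact hGP.edges s hs _ h3 ⟨_, (Real.exp_pos η).le, rfl⟩

theorem faceSum_zero_ne_zero {m : ℕ} {F : (Var m → ℂ) → ℂ} (hGP : GeneralizedPoincare F)
    {k : ℕ} (hk : 1 ≤ k) {q₀ : ℕ × ℕ} (hq₀ : q₀ ∈ lambda0Face F 0) :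
    faceSum F 0 (Real.log k) ≠ 0 := by
  have hk0 : (0 : ℝ) < k := by exact_mod_cast hk
  rw [faceSum, Real.exp_log hk0]
  by_cases hl : lastAbscissa F = 0
  · have hj : ∀ q ∈ lambda0Face F 0, q = q₀ := by
      intro q hq
      have h1 : ∀ q ∈ lambda0Face F 0, q.1 = 0 := fun q hq =>
        Nat.le_zero.1 (hl ▸ Finset.le_sup (f := fun q : ℕ × ℕ => q.1) hq)
      have e1 := (mem_lambda0Face le_rfl).1 hq
      have e2 := (mem_lambda0Face le_rfl).1 hq₀
      have e3 := e1.2 _ e2.1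
      have e4 := e2.2 _ e1.1
      simp only [zero_mul, zero_add, Nat.cast_le] at e3 e4
      exact Prod.ext ((h1 q hq).trans (h1 q₀ hq₀).symm) (le_antisymm e4 e3)
    rw [Finset.sum_eq_single q₀ (fun q hq hne => absurd (hj q hq) hne) (fun h => absurd hq₀ h)]
    exact mul_ne_zero (coeffC0_ne_zero ((mem_lambda0Face le_rfl).1 hq₀).1)
      (pow_ne_zero _ (Complex.ofReal_ne_zero.2 hk0.ne'))
  · intro h
    refine hGP.last k ?_ ⟨k, hk, rfl⟩
    rw [lastCharPoly, if_neg hl, Polynomial.IsRoot, Polynomial.eval_finsetSum, ← h]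
    refine Finset.sum_congr rfl fun q _ => ?_
    simp

/-- The monomial `k^j l^α`. -/
noncomputable def mono (k l : ℕ) (q : ℕ × ℕ) : ℝ := (k : ℝ) ^ q.1 * (l : ℝ) ^ q.2

theorem mono_pos {k l : ℕ} (hk : 1 ≤ k) (hl : 1 ≤ l) (q : ℕ × ℕ) : 0 < mono k l q := by
  have : (0 : ℝ) < k := by exact_mod_cast hk
  have : (0 : ℝ) < l := by exact_mod_cast hl
  unfold mono; positivity

theorem mono_div_mono_eq_exp {k l : ℕ} (hk : 1 ≤ k) (hl : 1 ≤ l) (q q₀ : ℕ × ℕ) :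
    mono k l q / mono k l q₀ = Real.exp (((q.1 : ℝ) - q₀.1) * Real.log k +
      ((q.2 : ℝ) - q₀.2) * Real.log l) := by
  have hk : (0 : ℝ) < k := by exact_mod_cast hk
  have hl : (0 : ℝ) < l := by exact_mod_cast hl
  have h : ∀ q : ℕ × ℕ, mono k l q = Real.exp (q.1 * Real.log k + q.2 * Real.log l) := fun q => by
    rw [Real.exp_add, Real.exp_nat_mul, Real.exp_nat_mul, Real.exp_log hk, Real.exp_log hl, mono]
  rw [h, h, ← Real.exp_sub]
  congr 1; ring

section Limit

variable {m : ℕ} {F : (Var m → ℂ) → ℂ} {U : Filter ℕ} {k l : ℕ → ℕ} {q₀ : ℕ × ℕ}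

theorem indicial_div_mono (hk : ∀ n, 1 ≤ k n) (hl : ∀ n, 1 ≤ l n) (n : ℕ) :
    indicial F (k n) (l n) / mono (k n) (l n) q₀ = -∑ q ∈ lambda0 F, coeffC0 F q *
      ((mono (k n) (l n) q / mono (k n) (l n) q₀ *
        ((l n).descFactorial q.2 / (l n : ℝ) ^ q.2) : ℝ) : ℂ) := by
  have h0 := (mono_pos (hk n) (hl n) q₀).ne'
  have hl0 : (l n : ℂ) ≠ 0 := by exact_mod_cast (Nat.one_le_iff_ne_zero.1 (hl n))
  rw [indicial_eq_neg_sum, neg_div, Finset.sum_div]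
  congr 1
  refine Finset.sum_congr rfl fun q _ => ?_
  have h0' : ((mono (k n) (l n) q₀ : ℝ) : ℂ) ≠ 0 := Complex.ofReal_ne_zero.2 h0
  push_cast [mono] at h0' ⊢
  field_simp

theorem tendsto_sum_of_tendsto_ratio (hk : ∀ n, 1 ≤ k n) (hl : ∀ n, 1 ≤ l n)
    {X e : ℕ × ℕ → ℝ}
    (hX : ∀ q ∈ lambda0 F, Tendsto (fun n => mono (k n) (l n) q / mono (k n) (l n) q₀) U
      (𝓝 (X q)))
    (he : ∀ q ∈ lambda0 F, Tendsto (fun n => ((l n).descFactorial q.2 : ℝ) / (l n : ℝ) ^ q.2) U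
      (𝓝 (e q))) :
    Tendsto (fun n => indicial F (k n) (l n) / mono (k n) (l n) q₀) U
      (𝓝 (-∑ q ∈ lambda0 F, coeffC0 F q * ((X q * e q : ℝ) : ℂ))) := by
  simp only [indicial_div_mono hk hl]
  exact (tendsto_finsetSum _ fun q hq => tendsto_const_nhds.mul
    ((Complex.continuous_ofReal.tendsto _).comp ((hX q hq).mul (he q hq)))).neg

theorem faceSum_eq_zero_of_tendsto [U.NeBot] (hk : ∀ n, 1 ≤ k n) (hl : ∀ n, 1 ≤ l n)
    (hq₀ : q₀ ∈ lambda0 F) {s η : ℝ} (hs : 0 ≤ s) (hlU : Tendsto l U atTop)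
    (hη : Tendsto (fun n => Real.log (k n) - s * Real.log (l n)) U (𝓝 η))
    (hmax : ∀ q ∈ lambda0 F, ∀ᶠ n in U, mono (k n) (l n) q ≤ mono (k n) (l n) q₀)
    (h0 : Tendsto (fun n => indicial F (k n) (l n) / mono (k n) (l n) q₀) U (𝓝 0)) :
    q₀ ∈ lambda0Face F s ∧ faceSum F s η = 0 ∧ ∀ q ∈ lambda0 F, q ∉ lambda0Face F s →
      Tendsto (fun n => mono (k n) (l n) q / mono (k n) (l n) q₀) U (𝓝 0) := by
  classical
  have hlog : Tendsto (fun n => Real.log (l n)) U atTop :=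
    Real.tendsto_log_atTop.comp (tendsto_natCast_atTop_atTop.comp hlU)
  set δ : ℕ × ℕ → ℝ := fun q => s * q.1 + q.2 - (s * q₀.1 + q₀.2) with hδ
  have hexp : ∀ q n, mono (k n) (l n) q / mono (k n) (l n) q₀ =
      Real.exp (((q.1 : ℝ) - q₀.1) * (Real.log (k n) - s * Real.log (l n)) +
        δ q * Real.log (l n)) := fun q n => by
    rw [mono_div_mono_eq_exp (hk n) (hl n)]
    congr 1; simp only [hδ]; ring
  have hδ0 : ∀ q ∈ lambda0 F, δ q ≤ 0 := by
    intro q hq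
    by_contra hpos
    push Not at hpos
    have h1 : Tendsto (fun n => mono (k n) (l n) q / mono (k n) (l n) q₀) U atTop := by
      simp only [hexp]
      exact Real.tendsto_exp_atTop.comp
        ((tendsto_const_nhds.mul hη).add_atTop (hlog.const_mul_atTop hpos))
    obtain ⟨n, hn1, hn2⟩ := ((h1.eventually_gt_atTop 1).and (hmax q hq)).exists
    rw [lt_div_iff₀ (mono_pos (hk n) (hl n) q₀), one_mul] at hn1
    exact absurd hn1 (not_lt.2 hn2)
  have hface : ∀ q, q ∈ lambda0Face F s ↔ q ∈ lambda0 F ∧ δ q = 0 := by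
    intro q
    rw [mem_lambda0Face hs]
    refine and_congr_right fun hq => ⟨fun h => ?_, fun h q' hq' => ?_⟩
    · have := h q₀ hq₀
      have := hδ0 q hq
      simp only [hδ] at this ⊢
      linarith
    · have := hδ0 q' hq'
      simp only [hδ] at this h
      linarith
  have hlim0 : ∀ q ∈ lambda0 F, q ∉ lambda0Face F s →
      Tendsto (fun n => mono (k n) (l n) q / mono (k n) (l n) q₀) U (𝓝 0) := by
    intro q hq hqf
    have hneg : δ q < 0 := lt_of_le_of_ne (hδ0 q hq) fun h => hqf ((hface q).2 ⟨hq, h⟩)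
    simp only [hexp]
    exact Real.tendsto_exp_atBot.comp
      ((tendsto_const_nhds.mul hη).add_atBot (hlog.const_mul_atTop_of_neg hneg))
  refine ⟨(hface q₀).2 ⟨hq₀, by simp [hδ]⟩, ?_, hlim0⟩
  have hX : ∀ q ∈ lambda0 F, Tendsto (fun n => mono (k n) (l n) q / mono (k n) (l n) q₀) U
      (𝓝 (if q ∈ lambda0Face F s then Real.exp (((q.1 : ℝ) - q₀.1) * η) else 0)) := by
    intro q hq
    split_ifs with hqf
    · simp only [hexp, ((hface q).1 hqf).2, zero_mul, add_zero]
      exact (Real.continuous_exp.tendsto _).comp (tendsto_const_nhds.mul hη)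
    · exact hlim0 q hq hqf
  have he : ∀ q ∈ lambda0 F, Tendsto (fun n => ((l n).descFactorial q.2 : ℝ) /
      (l n : ℝ) ^ q.2) U (𝓝 1) := fun q _ => (tendsto_descFactorial_div_pow q.2).comp hlU
  have hlim := tendsto_nhds_unique h0
    (tendsto_sum_of_tendsto_ratio (e := fun _ => 1) hk hl hX he)
  have hsub : (lambda0 F).filter (fun q => q ∈ lambda0Face F s) = lambda0Face F s := by
    ext q; rw [mem_filter]; exact ⟨fun h => h.2, fun h => ⟨((hface q).1 h).1, h⟩⟩
  have h2 : ∑ q ∈ lambda0Face F s, coeffC0 F q *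
      ((Real.exp (((q.1 : ℝ) - q₀.1) * η) : ℝ) : ℂ) = 0 := by
    rw [eq_comm, neg_eq_zero] at hlim
    rw [← hsub, Finset.sum_filter]
    refine Eq.trans ?_ hlim
    refine Finset.sum_congr rfl fun q _ => ?_
    split_ifs <;> simp
  have h3 : faceSum F s η = ((Real.exp (q₀.1 * η) : ℝ) : ℂ) * ∑ q ∈ lambda0Face F s,
      coeffC0 F q * ((Real.exp (((q.1 : ℝ) - q₀.1) * η) : ℝ) : ℂ) := by
    rw [faceSum, Finset.mul_sum]
    refine Finset.sum_congr rfl fun q _ => ?_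
    rw [mul_left_comm, ← Complex.ofReal_mul, ← Real.exp_add, ← Complex.ofReal_pow,
      ← Real.exp_nat_mul]
    congr 3; ring_nf
  rw [h3, h2, mul_zero]

end Limit

end TotChar

namespace TotChar

open Finset Filter Topology

theorem ultrafilter_eventually_const_or_tendsto (U : Ultrafilter ℕ) (k : ℕ → ℕ) :
    (∃ k₀, ∀ᶠ n in U, k n = k₀) ∨ Tendsto k U atTop := by
  by_cases h : Tendsto k U atTop
  · exact Or.inr h
  · left
    rw [tendsto_atTop] at h
    push Not at h
    obtain ⟨b, hb⟩ := h
    have h1 : ∀ᶠ n in U, ∃ a ∈ Set.Iio b, k n = a := by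
      filter_upwards [hb] with n hn
      exact ⟨k n, hn, rfl⟩
    obtain ⟨a, -, ha⟩ := (Ultrafilter.eventually_exists_mem_iff (Set.finite_Iio b)).1 h1
    exact ⟨a, ha⟩

theorem tendsto_indicial_div_pow {m : ℕ} (F : (Var m → ℂ) → ℂ) (l : ℕ) :
    Tendsto (fun k : ℕ => indicial F k l / (k : ℂ) ^ m) atTop (𝓝 1) := by
  have h : Tendsto (fun k : ℕ => (1 : ℂ) - ∑ q ∈ indexSet m, coeffC0 F q *
      (((k : ℝ) ^ q.1 / (k : ℝ) ^ m : ℝ) : ℂ) * ∏ i ∈ range q.2, ((l : ℂ) - (i : ℂ))) atTop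
      (𝓝 (1 - ∑ q ∈ indexSet m, coeffC0 F q * ((0 : ℝ) : ℂ) *
        ∏ i ∈ range q.2, ((l : ℂ) - (i : ℂ)))) := by
    refine tendsto_const_nhds.sub (tendsto_finsetSum _ fun q hq => Tendsto.mul_const _
      (tendsto_const_nhds.mul ((Complex.continuous_ofReal.tendsto _).comp ?_)))
    exact (tendsto_pow_div_pow_atTop_zero (mem_indexSet.1 hq).2).comp tendsto_natCast_atTop_atTop
  simp only [Complex.ofReal_zero, mul_zero, zero_mul, Finset.sum_const_zero, sub_zero] at h
  refine h.congr' ?_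
  filter_upwards [eventually_ge_atTop 1] with k hk
  have hk0 : (k : ℂ) ≠ 0 := Nat.cast_ne_zero.2 (by omega)
  rw [indicial, sub_div, div_self (pow_ne_zero _ hk0), Finset.sum_div]
  congr 1
  refine Finset.sum_congr rfl fun q _ => ?_
  push_cast
  field_simp

theorem exists_mono_le_norm_indicial {m : ℕ} {F : (Var m → ℂ) → ℂ} (hN : NonResonance F)
    (hGP : GeneralizedPoincare F) :
    ∃ C : ℝ, 0 < C ∧ ∀ k l : ℕ, 1 ≤ k → 1 ≤ l → ∀ q ∈ lambda0 F,
      mono k l q ≤ C * ‖indicial F k l‖ := by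
  by_contra hcon
  push Not at hcon
  have hseq : ∀ n : ℕ, ∃ k l : ℕ, 1 ≤ k ∧ 1 ≤ l ∧ ∃ q₀ ∈ lambda0 F,
      (∀ q ∈ lambda0 F, mono k l q ≤ mono k l q₀) ∧
      ((n : ℝ) + 1) * ‖indicial F k l‖ < mono k l q₀ := by
    intro n
    obtain ⟨k, l, hk, hl, q, hq, hlt⟩ := hcon ((n : ℝ) + 1) (by positivity)
    obtain ⟨q₀, hq₀, hmax⟩ := (lambda0 F).exists_max_image (mono k l) ⟨q, hq⟩
    exact ⟨k, l, hk, hl, q₀, hq₀, hmax, hlt.trans_le (hmax q hq)⟩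
  choose k l hk hl p hp hmax hlt using hseq
  set U : Ultrafilter ℕ := hyperfilter ℕ
  have hU : (U : Filter ℕ) ≤ atTop := Nat.hyperfilter_le_atTop
  obtain ⟨q₀, hq₀, hpq⟩ := (Ultrafilter.eventually_exists_mem_iff (f := U)
    (P := fun a n => p n = a) (lambda0 F).finite_toSet).1
    (Eventually.of_forall fun n => ⟨p n, hp n, rfl⟩)
  have hmax' : ∀ q ∈ lambda0 F, ∀ᶠ n in U, mono (k n) (l n) q ≤ mono (k n) (l n) q₀ := by
    intro q hq
    filter_upwards [hpq] with n hn
    exact hn ▸ hmax n q hq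
  have h0norm : Tendsto (fun n => ‖indicial F (k n) (l n)‖ / mono (k n) (l n) q₀) U (𝓝 0) := by
    have h1 : Tendsto (fun n : ℕ => 1 / ((n : ℝ) + 1)) U (𝓝 0) :=
      tendsto_one_div_add_atTop_nhds_zero_nat.mono_left hU
    refine tendsto_of_tendsto_of_tendsto_of_le_of_le' tendsto_const_nhds h1
      (Eventually.of_forall fun n => div_nonneg (norm_nonneg _) (mono_pos (hk n) (hl n) _).le) ?_
    filter_upwards [hpq] with n hn
    rw [div_le_div_iff₀ (mono_pos (hk n) (hl n) _) (by positivity), one_mul, mul_comm]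
    exact (hn ▸ hlt n).le
  have h0 : Tendsto (fun n => indicial F (k n) (l n) / mono (k n) (l n) q₀) U (𝓝 0) := by
    rw [tendsto_zero_iff_norm_tendsto_zero]
    refine h0norm.congr fun n => ?_
    rw [norm_div, Complex.norm_real, Real.norm_of_nonneg (mono_pos (hk n) (hl n) _).le]
  rcases ultrafilter_eventually_const_or_tendsto U l with ⟨l₀, hl₀⟩ | hlU
  · have hl₀1 : 1 ≤ l₀ := by
      obtain ⟨n, hn⟩ := hl₀.exists
      exact hn ▸ hl n
    rcases ultrafilter_eventually_const_or_tendsto U k with ⟨k₀, hk₀⟩ | hkU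
    · have hk₀1 : 1 ≤ k₀ := by
        obtain ⟨n, hn⟩ := hk₀.exists
        exact hn ▸ hk n
      have h1 : Tendsto (fun _ : ℕ => indicial F k₀ l₀ / mono k₀ l₀ q₀) U (𝓝 0) := by
        refine h0.congr' ?_
        filter_upwards [hl₀, hk₀] with n h1 h2
        rw [h1, h2]
      have h2 := tendsto_nhds_unique h1 tendsto_const_nhds
      rw [eq_comm, div_eq_zero_iff] at h2
      rcases h2 with h2 | h2
      · exact hN k₀ l₀ hk₀1 h2
      · exact (mono_pos hk₀1 hl₀1 q₀).ne' (by exact_mod_cast h2)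
    · have h1 := ((tendsto_indicial_div_pow F l₀).comp hkU).norm
      have h2 : Tendsto (fun n => ‖indicial F (k n) (l n)‖ / mono (k n) (l n) q₀ *
          (l₀ : ℝ) ^ q₀.2) U (𝓝 (0 * (l₀ : ℝ) ^ q₀.2)) := h0norm.mul_const _
      rw [zero_mul] at h2
      have h3 : ‖(1 : ℂ)‖ ≤ 0 := by
        refine le_of_tendsto_of_tendsto h1 h2 ?_
        filter_upwards [hl₀] with n hn
        have hk0 : (1 : ℝ) ≤ k n := by exact_mod_cast hk n
        have hk1 : (0 : ℝ) < k n := by positivity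
        have hl1 : (0 : ℝ) < l₀ := by exact_mod_cast hl₀1
        have hqm : q₀.1 ≤ m := by
          rcases mem_lambda0.1 hq₀ with h | h
          · rw [h]
          · exact (mem_indexSet.1 h.1).2.le
        have h4 : ‖indicial F (k n) l₀‖ / mono (k n) l₀ q₀ * (l₀ : ℝ) ^ q₀.2 =
            ‖indicial F (k n) l₀‖ / (k n : ℝ) ^ q₀.1 := by
          rw [mono]; field_simp
        simp only [Function.comp_apply, hn, norm_div, norm_pow, Complex.norm_natCast]
        rw [h4]
        gcongr
      simp at h3
      linarith
  · rcases ultrafilter_eventually_const_or_tendsto U k with ⟨k₀, hk₀⟩ | hkU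
    · have hk₀1 : 1 ≤ k₀ := by
        obtain ⟨n, hn⟩ := hk₀.exists
        exact hn ▸ hk n
      have hη : Tendsto (fun n => Real.log (k n) - 0 * Real.log (l n)) U (𝓝 (Real.log k₀)) := by
        refine tendsto_const_nhds.congr' ?_
        filter_upwards [hk₀] with n hn
        rw [hn]; ring
      obtain ⟨h1, h2, -⟩ := faceSum_eq_zero_of_tendsto hk hl hq₀ le_rfl hlU hη hmax' h0
      exact faceSum_zero_ne_zero hGP hk₀1 h1 h2
    · have hx : Tendsto (fun n => Real.log (k n)) U atTop :=
        Real.tendsto_log_atTop.comp (tendsto_natCast_atTop_atTop.comp hkU)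
      have hy : Tendsto (fun n => Real.log (l n)) U atTop :=
        Real.tendsto_log_atTop.comp (tendsto_natCast_atTop_atTop.comp hlU)
      have hX : ∀ q, ∃ X : ℝ, 0 ≤ X ∧ (q ∈ lambda0 F →
          Tendsto (fun n => mono (k n) (l n) q / mono (k n) (l n) q₀) U (𝓝 X)) := by
        intro q
        by_cases hq : q ∈ lambda0 F
        · obtain ⟨X, hX, hle⟩ := (isCompact_Icc (a := (0 : ℝ)) (b := 1)).ultrafilter_le_nhds
            (U.map fun n => mono (k n) (l n) q / mono (k n) (l n) q₀) (by
              rw [le_principal_iff, Ultrafilter.mem_coe, Ultrafilter.mem_map]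
              filter_upwards [hmax' q hq] with n hn
              have h1 := mono_pos (hk n) (hl n) q₀
              have h2 := mono_pos (hk n) (hl n) q
              exact ⟨by positivity, (div_le_one h1).2 hn⟩)
          exact ⟨X, hX.1, fun _ => hle⟩
        · exact ⟨0, le_rfl, fun h => absurd h hq⟩
      choose X hX0 hXt using hX
      have he : ∀ q ∈ lambda0 F, Tendsto (fun n => ((l n).descFactorial q.2 : ℝ) /
          (l n : ℝ) ^ q.2) U (𝓝 1) := fun q _ => (tendsto_descFactorial_div_pow q.2).comp hlU
      by_cases hq₁ : ∃ q₁ ∈ lambda0 F, q₁ ≠ q₀ ∧ X q₁ ≠ 0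
      · obtain ⟨q₁, hq₁, hne, hX₁⟩ := hq₁
        have hX₁ : 0 < X q₁ := lt_of_le_of_ne (hX0 q₁) (Ne.symm hX₁)
        have hlogt : Tendsto (fun n => ((q₁.1 : ℝ) - q₀.1) * Real.log (k n) +
            ((q₁.2 : ℝ) - q₀.2) * Real.log (l n)) U (𝓝 (Real.log (X q₁))) := by
          refine ((hXt q₁ hq₁).log hX₁.ne').congr fun n => ?_
          rw [mono_div_mono_eq_exp (hk n) (hl n), Real.log_exp]
        set a : ℝ := (q₁.1 : ℝ) - q₀.1 with ha
        set b : ℝ := (q₁.2 : ℝ) - q₀.2 with hb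
        have ha0 : a ≠ 0 := by
          intro ha0
          simp only [ha0, zero_mul, zero_add] at hlogt
          have hb0 : b ≠ 0 := by
            intro hb0
            refine hne (Prod.ext ?_ ?_)
            · exact_mod_cast sub_eq_zero.1 ha0
            · exact_mod_cast sub_eq_zero.1 hb0
          have := hlogt.const_mul b⁻¹
          simp only [inv_mul_cancel_left₀ hb0] at this
          exact not_tendsto_nhds_of_tendsto_atTop hy _ this
        have hη : Tendsto (fun n => Real.log (k n) - (-b / a) * Real.log (l n)) U
            (𝓝 (a⁻¹ * Real.log (X q₁))) := by
          refine (hlogt.const_mul a⁻¹).congr fun n => ?_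
          field_simp
          ring
        have hs : 0 < -b / a := by
          by_contra hs
          push Not at hs
          refine not_tendsto_nhds_of_tendsto_atTop (tendsto_atTop_mono (fun n => ?_) hx) _ hη
          have : 0 ≤ Real.log (l n) := Real.log_natCast_nonneg _
          nlinarith
        obtain ⟨h1, h2, h3⟩ := faceSum_eq_zero_of_tendsto hk hl hq₀ hs.le hlU hη hmax' h0
        have h4 : q₁ ∈ lambda0Face F (-b / a) := by
          by_contra h4
          exact hX₁.ne' (tendsto_nhds_unique (hXt q₁ hq₁) (h3 q₁ hq₁ h4))
        refine faceSum_ne_zero hGP ⟨hs, toPlane q₀, ?_, toPlane q₁, ?_, ?_⟩ _ h2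
        · classical
          rw [lambda0Face, mem_filter] at h1
          exact h1.2
        · classical
          rw [lambda0Face, mem_filter] at h4
          exact h4.2
        · intro h
          refine hne (Prod.ext ?_ ?_)
          · exact_mod_cast (show ((q₁.1 : ℕ) : ℝ) = q₀.1 from (congrArg Prod.fst h).symm)
          · exact_mod_cast (show ((q₁.2 : ℕ) : ℝ) = q₀.2 from (congrArg Prod.snd h).symm)
      · push Not at hq₁
        have hlim := tendsto_nhds_unique h0
          (tendsto_sum_of_tendsto_ratio (e := fun _ => 1) hk hl (fun q hq => hXt q hq) he)
        rw [Finset.sum_eq_single_of_mem q₀ hq₀ (fun q hq hne => by simp [hq₁ q hq hne])] at hlim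
        have hX1 : X q₀ = 1 := by
          refine tendsto_nhds_unique (hXt q₀ hq₀) (tendsto_const_nhds.congr fun n => ?_)
          rw [div_self (mono_pos (hk n) (hl n) q₀).ne']
        rw [hX1] at hlim
        simp only [mul_one, Complex.ofReal_one] at hlim
        exact coeffC0_ne_zero hq₀ (neg_eq_zero.1 hlim.symm)

theorem exists_pow_le_norm_indicial {m : ℕ} {F : (Var m → ℂ) → ℂ} (hN : NonResonance F)
    (hGP : GeneralizedPoincare F) :
    ∃ C : ℝ, 0 < C ∧ (∀ k l : ℕ, 1 ≤ k → (k : ℝ) ^ m ≤ C * ‖indicial F k l‖) ∧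
      ∀ k l : ℕ, 1 ≤ k → 1 ≤ l → ∀ q ∈ lambda0 F, mono k l q ≤ C * ‖indicial F k l‖ := by
  obtain ⟨C, hC, h⟩ := exists_mono_le_norm_indicial hN hGP
  have h1 := ((tendsto_indicial_div_pow F 0).norm.inv₀ (by simp)).bddAbove_range
  obtain ⟨C', hC'⟩ := h1
  refine ⟨max C C', lt_max_of_lt_left hC, fun k l hk => ?_, fun k l hk hl q hq =>
    (h k l hk hl q hq).trans (by gcongr; exact le_max_left _ _)⟩
  rcases Nat.eq_zero_or_pos l with rfl | hl
  · have hL : 0 < ‖indicial F k (0 : ℕ)‖ := norm_pos_iff.2 (hN k 0 hk)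
    have := hC' ⟨k, rfl⟩
    simp only [norm_div, norm_pow, Complex.norm_natCast, inv_div] at this
    rw [div_le_iff₀ hL] at this
    refine this.trans ?_
    gcongr
    exact le_max_right _ _
  · have := h k l hk hl _ (top_mem_lambda0 F)
    rw [mono, pow_zero, mul_one] at this
    refine this.trans ?_
    gcongr
    exact le_max_left _ _

theorem rpow_le_norm_indicial {m : ℕ} {F : (Var m → ℂ) → ℂ} {C : ℝ} {k l : ℕ} (hk : 1 ≤ k)
    (hl : 1 ≤ l) (h : ∀ q ∈ lambda0 F, mono k l q ≤ C * ‖indicial F k l‖)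
    {P : ℝ × ℝ} (hP : P ∈ newtonPolygon F) :
    (k : ℝ) ^ P.1 * (l : ℝ) ^ P.2 ≤ C * ‖indicial F k l‖ := by
  have hk0 : (0 : ℝ) < k := by exact_mod_cast hk
  have hl0 : (0 : ℝ) < l := by exact_mod_cast hl
  have hB : 0 < C * ‖indicial F k l‖ := (mono_pos hk hl _).trans_le (h _ (top_mem_lambda0 F))
  have h1 := le_of_mem_newtonPolygon (c := Real.log (C * ‖indicial F k l‖))
    (Real.log_natCast_nonneg k) (Real.log_natCast_nonneg l) (fun q hq => ?_) hP
  · rw [Real.rpow_def_of_pos hk0, Real.rpow_def_of_pos hl0, ← Real.exp_add]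
    exact (Real.exp_le_exp.2 h1).trans_eq (Real.exp_log hB)
  · have := Real.log_le_log (mono_pos hk hl _) (h q hq)
    rwa [mono, Real.log_mul (by positivity) (by positivity), Real.log_pow, Real.log_pow,
      mul_comm, mul_comm (q.2 : ℝ)] at this

theorem mono_le_rpow_excess {m : ℕ} {F : (Var m → ℂ) → ℂ} {C : ℝ} {k l : ℕ} (hk : 1 ≤ k)
    (hl : 1 ≤ l) (h : ∀ q ∈ lambda0 F, mono k l q ≤ C * ‖indicial F k l‖)
    {q : ℕ × ℕ} (hq : q ∈ indexSet m) :
    mono k l q ≤ C * ‖indicial F k l‖ * (l : ℝ) ^ excess F q := by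
  have hk0 : (0 : ℝ) < k := by exact_mod_cast hk
  have hl0 : (0 : ℝ) < l := by exact_mod_cast hl
  have hB : 0 < C * ‖indicial F k l‖ := (mono_pos hk hl _).trans_le (h _ (top_mem_lambda0 F))
  set S := {y : ℝ | ((q.1 : ℝ), (q.2 : ℝ) - y) ∈ newtonPolygon F} with hS
  have hmem : (q.2 : ℝ) ∈ S := by
    refine toPlane_mem_newtonPolygon (top_mem_lambda0 F) ⟨?_, ?_⟩
    · have := (mem_indexSet.1 hq).2.le
      simpa [toPlane] using this
    · simp [toPlane]
  have hy : ∀ y ∈ S, Real.log (mono k l q) ≤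
      Real.log (C * ‖indicial F k l‖) + y * Real.log l := by
    intro y hy
    have h1 := rpow_le_norm_indicial hk hl h hy
    rw [Real.rpow_natCast, Real.rpow_sub hl0, Real.rpow_natCast] at h1
    have h2 : mono k l q ≤ C * ‖indicial F k l‖ * (l : ℝ) ^ y := by
      rw [← mul_div_assoc, div_le_iff₀ (by positivity)] at h1
      exact h1
    have h3 := Real.log_le_log (mono_pos hk hl _) h2
    rwa [Real.log_mul hB.ne' (by positivity), Real.log_rpow hl0] at h3
  have hfin : Real.log (mono k l q) ≤
      Real.log (C * ‖indicial F k l‖) + excess F q * Real.log l := by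
    rcases (Real.log_natCast_nonneg l).eq_or_lt with h0 | hpos
    · have := hy _ hmem
      rw [← h0] at this ⊢
      simpa using this
    · have : (Real.log (mono k l q) - Real.log (C * ‖indicial F k l‖)) / Real.log l ≤
          excess F q := by
        refine le_csInf ⟨_, hmem⟩ fun y hyS => ?_
        rw [div_le_iff₀ hpos]
        linarith [hy y hyS]
      rw [div_le_iff₀ hpos] at this
      linarith
  rw [← Real.exp_log (mono_pos hk hl q), Real.rpow_def_of_pos hl0,
    ← Real.exp_log (Real.exp_pos _)]
  rw [Real.exp_log (Real.exp_pos _), mul_comm (Real.log l)]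
  conv_rhs => rw [← Real.exp_log hB]
  rw [← Real.exp_add]
  exact Real.exp_le_exp.2 hfin

end TotChar

namespace TotChar

open Finset

open scoped Nat

/-! ### The irregularity -/

theorem bddAbove_irregularity {m : ℕ} (F : (Var m → ℂ) → ℂ) :
    BddAbove (insert 1 ((fun q => ((zeroOrder F q : ℝ) + excess F q) / (zeroOrder F q : ℝ)) ''
      lambda1 F)) := by
  have : (lambda1 F).Finite := (indexSet m).finite_toSet.subset fun q hq => hq.1
  exact ((this.image _).insert 1).bddAbove

theorem one_le_irregularity {m : ℕ} (F : (Var m → ℂ) → ℂ) : 1 ≤ irregularity F :=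
  le_csSup (bddAbove_irregularity F) (Set.mem_insert _ _)

theorem excess_le {m : ℕ} {F : (Var m → ℂ) → ℂ} {q : ℕ × ℕ} (hq : q ∈ lambda1 F)
    (h0 : 1 ≤ zeroOrder F q) : excess F q ≤ zeroOrder F q * (irregularity F - 1) := by
  have h : ((zeroOrder F q : ℝ) + excess F q) / (zeroOrder F q : ℝ) ≤ irregularity F :=
    le_csSup (bddAbove_irregularity F) (Set.mem_insert_of_mem _ ⟨q, hq, rfl⟩)
  have h1 : (0 : ℝ) < zeroOrder F q := by exact_mod_cast h0
  rw [div_le_iff₀ h1] at h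
  linarith

theorem pow_le_factorial_mul_descFactorial {r l : ℕ} (h : r ≤ l) :
    l ^ r ≤ r ! * l.descFactorial r := by
  induction r with
  | zero => simp
  | succ r ih =>
    rw [pow_succ', Nat.factorial_succ, Nat.descFactorial_succ]
    have h1 : l ≤ (r + 1) * (l - r) := by
      obtain ⟨d, rfl⟩ := Nat.exists_eq_add_of_le h
      have : r + 1 + d - r = d + 1 := by omega
      rw [this]; nlinarith
    calc l * l ^ r ≤ ((r + 1) * (l - r)) * (r ! * l.descFactorial r) :=
          Nat.mul_le_mul h1 (ih (by omega))
      _ = _ := by ring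

theorem exists_mono_le_indicial_mul {m : ℕ} {F : (Var m → ℂ) → ℂ} (hN : NonResonance F)
    (hGP : GeneralizedPoincare F) :
    ∃ C : ℝ, 0 < C ∧ (∀ k l : ℕ, 1 ≤ k → (k : ℝ) ^ m ≤ C * ‖indicial F k l‖) ∧
      ∀ q ∈ indexSet m, ∀ k l p : ℕ, 1 ≤ k → 1 ≤ p → p ≤ l →
        PowerSeries.coeff p (coeffC F q) ≠ 0 →
        mono k l q ≤ C * ‖indicial F k l‖ *
          (l.descFactorial p : ℝ) ^ (irregularity F - 1) := by
  obtain ⟨C, hC, h1, h2⟩ := exists_pow_le_norm_indicial hN hGP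
  have hσ : 0 ≤ irregularity F - 1 := sub_nonneg.2 (one_le_irregularity F)
  set B : ℝ := 1 + ∑ q ∈ indexSet m, ((zeroOrder F q)! : ℝ) ^ (irregularity F - 1) with hB
  have hsum : 0 ≤ ∑ q ∈ indexSet m, ((zeroOrder F q)! : ℝ) ^ (irregularity F - 1) :=
    Finset.sum_nonneg fun _ _ => by positivity
  have hB1 : 1 ≤ B := by linarith
  refine ⟨C * B, by positivity, fun k l hk => (h1 k l hk).trans ?_, ?_⟩
  · have : 0 ≤ C * ‖indicial F k l‖ := by positivity
    nlinarith
  · intro q hq k l p hk hp hpl hne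
    have hl : 1 ≤ l := hp.trans hpl
    have hdesc : ∀ r, r ≤ l → (1 : ℝ) ≤ (l.descFactorial r : ℝ) := fun r hr => by
      exact_mod_cast Nat.one_le_iff_ne_zero.2 fun h =>
        absurd (Nat.descFactorial_eq_zero_iff_lt.1 h) (not_lt.2 hr)
    have hL : 0 ≤ C * ‖indicial F k l‖ := by positivity
    by_cases hc0 : coeffC0 F q = 0
    · have hq1 : q ∈ lambda1 F := ⟨hq, hc0, fun h => hne (by rw [h, map_zero])⟩
      have hord : (coeffC F q).order ≠ ⊤ := fun h => hq1.2.2 (PowerSeries.order_eq_top.1 h)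
      have hz : ((zeroOrder F q : ℕ) : ℕ∞) = (coeffC F q).order := ENat.natCast_toNat hord
      have hz1 : 1 ≤ zeroOrder F q := by
        by_contra h
        have h0 : zeroOrder F q = 0 := by omega
        rw [h0] at hz
        have h3 := PowerSeries.coeff_order hq1.2.2
        rw [← hz] at h3
        exact h3 (by simpa [coeffC0] using hc0)
      have hzp : zeroOrder F q ≤ p := by
        have := PowerSeries.order_le p hne
        rw [← hz] at this
        exact_mod_cast this
      have hl0 : (1 : ℝ) ≤ l := by exact_mod_cast hl
      have h3 := mono_le_rpow_excess hk hl (h2 k l hk hl) hq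
      have h4 : (l : ℝ) ^ excess F q ≤
          ((zeroOrder F q)! : ℝ) ^ (irregularity F - 1) *
            (l.descFactorial p : ℝ) ^ (irregularity F - 1) := by
        calc (l : ℝ) ^ excess F q ≤ (l : ℝ) ^ ((zeroOrder F q : ℝ) * (irregularity F - 1)) :=
              Real.rpow_le_rpow_of_exponent_le hl0 (excess_le hq1 hz1)
          _ = ((l : ℝ) ^ zeroOrder F q) ^ (irregularity F - 1) := by
              rw [Real.rpow_mul (by positivity), Real.rpow_natCast]
          _ ≤ (((zeroOrder F q)! : ℝ) * (l.descFactorial p : ℝ)) ^ (irregularity F - 1) := by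
              refine Real.rpow_le_rpow (by positivity) ?_ hσ
              have h5 := (pow_le_factorial_mul_descFactorial (hzp.trans hpl)).trans
                (Nat.mul_le_mul_left _ (?_ : l.descFactorial (zeroOrder F q) ≤ l.descFactorial p))
              · exact_mod_cast h5
              · rw [← Nat.descFactorial_mul_descFactorial hzp]
                refine Nat.le_mul_of_pos_left _ (Nat.pos_of_ne_zero fun h => ?_)
                have := Nat.descFactorial_eq_zero_iff_lt.1 h
                omega
          _ = _ := Real.mul_rpow (by positivity) (by positivity)
      have h5 : ((zeroOrder F q)! : ℝ) ^ (irregularity F - 1) ≤ B := by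
        have := Finset.single_le_sum
          (f := fun q => ((zeroOrder F q)! : ℝ) ^ (irregularity F - 1))
          (fun _ _ => by positivity) hq
        linarith
      refine h3.trans ?_
      calc C * ‖indicial F k l‖ * (l : ℝ) ^ excess F q ≤ C * ‖indicial F k l‖ *
            (B * (l.descFactorial p : ℝ) ^ (irregularity F - 1)) := by
              gcongr
              exact h4.trans (by gcongr)
        _ = _ := by ring
    · have h3 := h2 k l hk hl q (mem_lambda0.2 (Or.inr ⟨hq, hc0⟩))
      have h4 : 1 ≤ (l.descFactorial p : ℝ) ^ (irregularity F - 1) :=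
        Real.one_le_rpow (hdesc p hpl) hσ
      calc mono k l q ≤ C * ‖indicial F k l‖ * (1 * 1) := by simpa using h3
        _ ≤ C * ‖indicial F k l‖ * (B * (l.descFactorial p : ℝ) ^ (irregularity F - 1)) := by
            gcongr
        _ = _ := by ring

/-! ### A family of majorants -/

/-- The coefficients of the majorants `∑ (a (a + 1) ⋯ (a + l - 1))^σ / l! x^l`. -/
noncomputable def theta (σ : ℝ) (a l : ℕ) : ℝ := (a.ascFactorial l : ℝ) ^ σ / (l ! : ℝ)

section Theta

variable {σ : ℝ}

theorem theta_nonneg (σ : ℝ) (a l : ℕ) : 0 ≤ theta σ a l := by unfold theta; positivity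

theorem factorial_le_ascFactorial {a : ℕ} (ha : 1 ≤ a) (l : ℕ) : l ! ≤ a.ascFactorial l := by
  rw [← Nat.one_ascFactorial]; exact Nat.ascFactorial_le l ha

theorem ascFactorial_pos_of_pos {a : ℕ} (ha : 1 ≤ a) (l : ℕ) : 0 < a.ascFactorial l :=
  (Nat.factorial_pos l).trans_le (factorial_le_ascFactorial ha l)

theorem one_le_theta (hσ : 1 ≤ σ) {a : ℕ} (ha : 1 ≤ a) (l : ℕ) : 1 ≤ theta σ a l := by
  have h1 : (1 : ℝ) ≤ l ! := by exact_mod_cast Nat.factorial_pos l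
  have h2 : (l ! : ℝ) ≤ a.ascFactorial l := by exact_mod_cast factorial_le_ascFactorial ha l
  rw [theta, le_div_iff₀ (by positivity), one_mul]
  exact h2.trans (Real.self_le_rpow_of_one_le (h1.trans h2) hσ)

theorem theta_mono_left (hσ : 1 ≤ σ) {a b : ℕ} (h : a ≤ b) (l : ℕ) :
    theta σ a l ≤ theta σ b l := by
  unfold theta
  have : (a.ascFactorial l : ℝ) ≤ b.ascFactorial l := by
    exact_mod_cast Nat.ascFactorial_le l h
  gcongr

theorem theta_mul_descFactorial_le (hσ : 1 ≤ σ) {a : ℕ} (ha : 1 ≤ a) {p l : ℕ} (hp : p ≤ l) :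
    theta σ a (l - p) * (l.descFactorial p : ℝ) ^ (σ - 1) ≤ theta σ a l := by
  obtain ⟨d, rfl⟩ := Nat.exists_eq_add_of_le hp
  rw [Nat.add_sub_cancel_left]
  have h1 : d ! * (p + d).descFactorial p = (p + d)! := by
    have := Nat.factorial_mul_descFactorial (n := p + d) (k := p) (by omega)
    rwa [Nat.add_sub_cancel_left] at this
  have h2 : a.ascFactorial d * (p + d).descFactorial p ≤ a.ascFactorial (p + d) := by
    rw [add_comm p d, ← Nat.ascFactorial_mul_ascFactorial, Nat.add_descFactorial_eq_ascFactorial]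
    exact Nat.mul_le_mul_left _ (Nat.ascFactorial_le _ (by omega))
  have hdpos : (0 : ℝ) < (p + d).descFactorial p := by
    exact_mod_cast Nat.pos_of_ne_zero fun h => by
      have := Nat.descFactorial_eq_zero_iff_lt.1 h; omega
  have h1' : (d ! : ℝ) * (p + d).descFactorial p = (p + d)! := by exact_mod_cast h1
  have h2' : (a.ascFactorial d : ℝ) * (p + d).descFactorial p ≤ a.ascFactorial (p + d) := by
    exact_mod_cast h2
  have h3 : (0 : ℝ) < d ! := by exact_mod_cast Nat.factorial_pos d
  rw [theta, theta, ← h1', Real.rpow_sub_one hdpos.ne', div_mul_div_comm,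
    ← Real.mul_rpow (by positivity) (by positivity)]
  gcongr

theorem theta_mono_right (hσ : 1 ≤ σ) {a : ℕ} (ha : 1 ≤ a) {l l' : ℕ} (h : l ≤ l') :
    theta σ a l ≤ theta σ a l' := by
  have h1 := theta_mul_descFactorial_le hσ ha (Nat.sub_le l' l)
  rw [Nat.sub_sub_self h] at h1
  refine le_trans ?_ h1
  refine le_mul_of_one_le_right (theta_nonneg _ _ _) (Real.one_le_rpow ?_ (by linarith))
  exact_mod_cast Nat.pos_of_ne_zero fun h => by
    have := Nat.descFactorial_eq_zero_iff_lt.1 h; omega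

theorem sum_choose_mul_ascFactorial (a b l : ℕ) :
    ∑ p ∈ HasAntidiagonal.antidiagonal l,
      l.choose p.1 * (a.ascFactorial p.1 * b.ascFactorial p.2) = (a + b).ascFactorial l := by
  induction l generalizing a b with
  | zero => simp
  | succ l ih =>
    have key : ∀ c n : ℕ, c.ascFactorial (n + 1) = c * (c + 1).ascFactorial n := fun c n => by
      rw [add_comm n 1, ← Nat.ascFactorial_mul_ascFactorial, Nat.ascFactorial_succ,
        Nat.ascFactorial_zero, add_zero, mul_one]
    have h := Finset.sum_antidiagonal_choose_succ_mul
      (fun i j => a.ascFactorial i * b.ascFactorial j) l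
    simp only [Nat.cast_id] at h
    rw [h, key]
    have h1 : ∑ p ∈ HasAntidiagonal.antidiagonal l,
        l.choose p.1 * (a.ascFactorial p.1 * b.ascFactorial (p.2 + 1)) =
        b * (a + b + 1).ascFactorial l := by
      rw [add_assoc, ← ih a (b + 1), Finset.mul_sum]
      refine Finset.sum_congr rfl fun p _ => ?_
      rw [key]; ring
    have h2 : ∑ p ∈ HasAntidiagonal.antidiagonal l,
        l.choose p.2 * (a.ascFactorial (p.1 + 1) * b.ascFactorial p.2) =
        a * (a + b + 1).ascFactorial l := by
      rw [show a + b + 1 = a + 1 + b by ring, ← ih (a + 1) b, Finset.mul_sum]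
      refine Finset.sum_congr rfl fun p hp => ?_
      rw [key, Nat.choose_symm_of_eq_add (HasAntidiagonal.mem_antidiagonal.1 hp).symm]; ring
    rw [h1, h2]; ring

theorem sum_rpow_le_rpow_sum (hσ : 1 ≤ σ) {ι : Type*} (s : Finset ι) {f : ι → ℝ}
    (hf : ∀ i ∈ s, 0 ≤ f i) : ∑ i ∈ s, f i ^ σ ≤ (∑ i ∈ s, f i) ^ σ := by
  have hS : 0 ≤ ∑ i ∈ s, f i := Finset.sum_nonneg hf
  have hsplit : ∀ x : ℝ, 0 ≤ x → x ^ σ = x * x ^ (σ - 1) := fun x hx => by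
    rw [← Real.rpow_one_add' hx (by linarith)]; congr 1; ring
  rw [hsplit _ hS, Finset.sum_mul]
  refine Finset.sum_le_sum fun i hi => ?_
  rw [hsplit _ (hf i hi)]
  exact mul_le_mul_of_nonneg_left (Real.rpow_le_rpow (hf i hi) (Finset.single_le_sum hf hi)
    (by linarith)) (hf i hi)

theorem sum_theta_mul_theta_le (hσ : 1 ≤ σ) (a b l : ℕ) :
    ∑ p ∈ HasAntidiagonal.antidiagonal l, theta σ a p.1 * theta σ b p.2 ≤
      theta σ (a + b) l := by
  have h1 : ∀ p ∈ HasAntidiagonal.antidiagonal l, theta σ a p.1 * theta σ b p.2 ≤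
      ((l.choose p.1 * (a.ascFactorial p.1 * b.ascFactorial p.2) : ℕ) : ℝ) ^ σ / (l ! : ℝ) := by
    intro p hp
    have hp := HasAntidiagonal.mem_antidiagonal.1 hp
    have hle : p.1 ≤ l := by omega
    have hc : (1 : ℝ) ≤ l.choose p.1 := by exact_mod_cast Nat.choose_pos hle
    have hch : (l.choose p.1 : ℝ) * p.1 ! * p.2 ! = l ! := by
      have := Nat.choose_mul_factorial_mul_factorial hle
      rw [show l - p.1 = p.2 by omega] at this
      exact_mod_cast this
    have h1 : (0 : ℝ) < p.1 ! := by exact_mod_cast Nat.factorial_pos _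
    have h2 : (0 : ℝ) < p.2 ! := by exact_mod_cast Nat.factorial_pos _
    rw [theta, theta, ← hch]
    push_cast
    rw [Real.mul_rpow (by positivity) (by positivity), Real.mul_rpow (by positivity)
      (by positivity), div_mul_div_comm, div_le_div_iff₀ (by positivity) (by positivity)]
    have h3 : (l.choose p.1 : ℝ) ≤ (l.choose p.1 : ℝ) ^ σ := Real.self_le_rpow_of_one_le hc hσ
    calc (a.ascFactorial p.1 : ℝ) ^ σ * (b.ascFactorial p.2 : ℝ) ^ σ *
          ((l.choose p.1 : ℝ) * p.1 ! * p.2 !) =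
        (l.choose p.1 : ℝ) * ((a.ascFactorial p.1 : ℝ) ^ σ * (b.ascFactorial p.2 : ℝ) ^ σ *
          (p.1 ! * p.2 !)) := by ring
      _ ≤ (l.choose p.1 : ℝ) ^ σ * ((a.ascFactorial p.1 : ℝ) ^ σ * (b.ascFactorial p.2 : ℝ) ^ σ *
          (p.1 ! * p.2 !)) := by gcongr
      _ = _ := by ring
  refine (Finset.sum_le_sum h1).trans ?_
  rw [← Finset.sum_div, theta, ← sum_choose_mul_ascFactorial, Nat.cast_sum]
  gcongr
  exact sum_rpow_le_rpow_sum hσ _ fun _ _ => by positivity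

theorem theta_le (hσ : 1 ≤ σ) (a l : ℕ) :
    theta σ a l ≤ (2 ^ (a + l)) ^ σ * (l ! : ℝ) ^ (σ - 1) := by
  have h0 : (0 : ℝ) < l ! := by exact_mod_cast Nat.factorial_pos l
  have h1 : a.ascFactorial l ≤ 2 ^ (a + l) * l ! := by
    refine (Nat.ascFactorial_le l (Nat.le_succ a)).trans ?_
    rw [Nat.ascFactorial_eq_factorial_mul_choose, mul_comm]
    exact Nat.mul_le_mul_right _ (Nat.choose_le_two_pow _ _)
  have h1' : (a.ascFactorial l : ℝ) ≤ 2 ^ (a + l) * l ! := by exact_mod_cast h1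
  rw [theta, Real.rpow_sub_one h0.ne', ← mul_div_assoc,
    ← Real.mul_rpow (by positivity) (by positivity)]
  gcongr

/-- The exponent of the loss under `x^q ∂_x^α`. -/
noncomputable def lossExponent (σ : ℝ) (q α : ℕ) : ℝ :=
  if q < α then σ * ((α : ℝ) - q) + q else α

theorem ascFactorial_le_pow (a n : ℕ) : a.ascFactorial n ≤ (a + n) ^ n :=
  (Nat.ascFactorial_le n (Nat.le_succ a)).trans (Nat.ascFactorial_le_pow_add a n)

theorem descFactorial_mul_theta_add (σ : ℝ) (a l α : ℕ) :
    ((l + α).descFactorial α : ℝ) * theta σ a (l + α) =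
      (a.ascFactorial α : ℝ) ^ σ * theta σ (a + α) l := by
  have h1 : (l ! : ℝ) * (l + α).descFactorial α = (l + α)! := by
    have := Nat.factorial_mul_descFactorial (n := l + α) (k := α) (by omega)
    rw [Nat.add_sub_cancel] at this
    exact_mod_cast this
  have h0 : (l ! : ℝ) ≠ 0 := by exact_mod_cast (Nat.factorial_pos l).ne'
  have h2 : ((l + α).descFactorial α : ℝ) ≠ 0 := fun h => by
    rw [h, mul_zero] at h1
    exact absurd h1.symm (by exact_mod_cast (Nat.factorial_pos _).ne')
  rw [theta, theta, add_comm l α, ← Nat.ascFactorial_mul_ascFactorial, Nat.cast_mul,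
    Real.mul_rpow (by positivity) (by positivity), add_comm α l, ← h1]
  field_simp

theorem descFactorial_mul_theta_le (hσ : 1 ≤ σ) {b : ℕ} (hb : 1 ≤ b) (l q : ℕ) :
    (l.descFactorial q : ℝ) * theta σ b l ≤ (b.ascFactorial q : ℝ) * theta σ (b + q) l := by
  have hle : l.descFactorial q ≤ (b + l).ascFactorial q := by
    rcases le_or_gt q l with h | h
    · obtain ⟨d, rfl⟩ := Nat.exists_eq_add_of_le h
      rw [add_comm q d, Nat.add_descFactorial_eq_ascFactorial]
      exact Nat.ascFactorial_le _ (by omega)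
    · rw [Nat.descFactorial_of_lt h]; exact Nat.zero_le _
  set r : ℝ := ((b + q).ascFactorial l : ℝ) / b.ascFactorial l with hr
  have hbl : (0 : ℝ) < b.ascFactorial l := by exact_mod_cast ascFactorial_pos_of_pos hb l
  have hr1 : 1 ≤ r := by
    rw [hr, le_div_iff₀ hbl, one_mul]
    exact_mod_cast Nat.ascFactorial_le l (Nat.le_add_right b q)
  have h1 : (l.descFactorial q : ℝ) ≤ b.ascFactorial q * r := by
    rw [hr, ← mul_div_assoc, le_div_iff₀ hbl]
    have h2 : b.ascFactorial q * (b + q).ascFactorial l =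
        b.ascFactorial l * (b + l).ascFactorial q := by
      rw [Nat.ascFactorial_mul_ascFactorial, Nat.ascFactorial_mul_ascFactorial, add_comm]
    have h3 : l.descFactorial q * b.ascFactorial l ≤
        b.ascFactorial q * (b + q).ascFactorial l := by
      rw [h2, mul_comm]; exact Nat.mul_le_mul_left _ hle
    exact_mod_cast h3
  have h2 : theta σ (b + q) l = r ^ σ * theta σ b l := by
    rw [theta, theta, hr, Real.div_rpow (by positivity) (by positivity)]
    have : (b.ascFactorial l : ℝ) ^ σ ≠ 0 := by positivity
    field_simp
  rw [h2, ← mul_assoc]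
  refine mul_le_mul_of_nonneg_right (h1.trans ?_) (theta_nonneg _ _ _)
  gcongr
  exact Real.self_le_rpow_of_one_le hr1 hσ

theorem descFactorial_mul_theta_shift_le (hσ : 1 ≤ σ) {a : ℕ} (ha : 1 ≤ a) {q l : ℕ}
    (hq : q ≤ l) (α : ℕ) :
    ((l - q + α).descFactorial α : ℝ) * theta σ a (l - q + α) ≤
      ((a : ℝ) + α) ^ lossExponent σ q α * theta σ (a + α) l := by
  have hbase : (0 : ℝ) < (a : ℝ) + α := by positivity
  unfold lossExponent
  split_ifs with hqα
  · obtain ⟨d, rfl⟩ := Nat.exists_eq_add_of_le hqα.le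
    obtain ⟨e, rfl⟩ := Nat.exists_eq_add_of_le hq
    have h1 : q + e - q + (q + d) = q + e + d := by omega
    have h2 : (q + e + d).descFactorial (q + d) =
        (q + e + d).descFactorial d * (q + e).descFactorial q := by
      have := Nat.descFactorial_mul_descFactorial (k := d) (m := q + d) (n := q + e + d)
        (by omega)
      rw [Nat.add_sub_cancel, Nat.add_sub_cancel] at this
      rw [← this, mul_comm]
    rw [h1, h2, Nat.cast_mul, mul_right_comm, descFactorial_mul_theta_add, mul_assoc,
      mul_comm (theta _ _ _)]
    have h3 := descFactorial_mul_theta_le hσ (b := a + d) (by omega) (q + e) q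
    have h4 : (a.ascFactorial d : ℝ) ≤ ((a : ℝ) + ((q + d : ℕ) : ℝ)) ^ d := by
      refine le_trans (b := ((a : ℝ) + d) ^ d) (by exact_mod_cast ascFactorial_le_pow a d) ?_
      gcongr; omega
    have h5 : ((a + d).ascFactorial q : ℝ) ≤ ((a : ℝ) + ((q + d : ℕ) : ℝ)) ^ q := by
      have := ascFactorial_le_pow (a + d) q
      rw [show a + d + q = a + (q + d) by ring] at this
      exact_mod_cast this
    rw [show a + d + q = a + (q + d) by ring] at h3
    rw [Real.rpow_add hbase, Real.rpow_natCast, mul_comm σ,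
      show (((q + d : ℕ) : ℝ) - q) = d by push_cast; ring, Real.rpow_mul hbase.le,
      Real.rpow_natCast, mul_assoc]
    refine mul_le_mul (Real.rpow_le_rpow (by positivity) h4 (by linarith))
      (h3.trans ?_) (by have := theta_nonneg σ (a + d) (q + e); positivity) (by positivity)
    exact mul_le_mul_of_nonneg_right h5 (theta_nonneg _ _ _)
  · have h1 := descFactorial_mul_theta_le hσ ha (l - q + α) α
    have h2 : (a.ascFactorial α : ℝ) ≤ ((a : ℝ) + α) ^ α := by
      exact_mod_cast ascFactorial_le_pow a α
    rw [Real.rpow_natCast]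
    refine h1.trans (mul_le_mul h2 (theta_mono_right hσ (by omega) (by omega))
      (theta_nonneg _ _ _) (by positivity))

end Theta

end TotChar

namespace TotChar

open Finset

/-! ### Majorants for the coefficients in `t` -/

/-- The coefficient of `t^k`, as a series in `x`. -/
noncomputable def row (f : MvPowerSeries (Fin 2) ℂ) (k : ℕ) : PowerSeries ℂ :=
  PowerSeries.mk fun l => coeffTX f k l

@[simp] theorem coeff_row (f : MvPowerSeries (Fin 2) ℂ) (k l : ℕ) :
    PowerSeries.coeff l (row f k) = coeffTX f k l := by
  rw [row, PowerSeries.coeff_mk]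

theorem row_mul (f g : MvPowerSeries (Fin 2) ℂ) (k : ℕ) :
    row (f * g) k = ∑ a ∈ HasAntidiagonal.antidiagonal k, row f a.1 * row g a.2 := by
  ext l
  rw [coeff_row, coeffTX_mul, map_sum]
  refine Finset.sum_congr rfl fun a _ => ?_
  rw [PowerSeries.coeff_mul]
  simp only [coeff_row]

/-- The series `f` is majorized by `C ∑ θ_{a,l} (x / R)^l`. -/
def RowBound (σ R C : ℝ) (a : ℕ) (f : PowerSeries ℂ) : Prop :=
  ∀ l, ‖PowerSeries.coeff l f‖ ≤ C * theta σ a l / R ^ l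

section

variable {σ R : ℝ}

theorem RowBound.mul (hσ : 1 ≤ σ) (hR : 0 < R) {C C' : ℝ} {a a' : ℕ} {f g : PowerSeries ℂ}
    (hC : 0 ≤ C) (hC' : 0 ≤ C') (hf : RowBound σ R C a f) (hg : RowBound σ R C' a' g) :
    RowBound σ R (C * C') (a + a') (f * g) := by
  intro l
  rw [PowerSeries.coeff_mul]
  have h : ∀ p ∈ HasAntidiagonal.antidiagonal l,
      ‖PowerSeries.coeff p.1 f * PowerSeries.coeff p.2 g‖ ≤
        C * C' / R ^ l * (theta σ a p.1 * theta σ a' p.2) := by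
    intro p hp
    rw [norm_mul]
    refine (mul_le_mul (hf p.1) (hg p.2) (norm_nonneg _) ?_).trans_eq ?_
    · have := theta_nonneg σ a p.1; positivity
    · rw [← HasAntidiagonal.mem_antidiagonal.1 hp, pow_add]
      field_simp
  refine (norm_sum_le_of_le _ h).trans ?_
  rw [← Finset.mul_sum, mul_div_right_comm (C * C')]
  exact mul_le_mul_of_nonneg_left (sum_theta_mul_theta_le hσ a a' l) (by positivity)

theorem RowBound.mono {C C' : ℝ} {a : ℕ} {f : PowerSeries ℂ} (hR : 0 < R)
    (hf : RowBound σ R C a f) (h : C ≤ C') : RowBound σ R C' a f := fun l =>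
  (hf l).trans (by have := theta_nonneg σ a l; gcongr)

theorem RowBound.sum {ι : Type*} {s : Finset ι} {C : ι → ℝ} {a : ℕ} {f : ι → PowerSeries ℂ}
    (h : ∀ i ∈ s, RowBound σ R (C i) a (f i)) :
    RowBound σ R (∑ i ∈ s, C i) a (∑ i ∈ s, f i) := by
  intro l
  rw [map_sum, Finset.sum_mul, Finset.sum_div]
  exact norm_sum_le_of_le _ fun i hi => h i hi l

theorem sum_range_one_div_sq_le (k : ℕ) :
    ∑ i ∈ range (k + 1), 1 / ((i : ℝ) + 1) ^ 2 ≤ 2 - 1 / ((k : ℝ) + 1) := by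
  induction k with
  | zero => norm_num
  | succ k ih =>
    rw [Finset.sum_range_succ]
    have h : 1 / (((k + 1 : ℕ) : ℝ) + 1) ^ 2 ≤
        1 / ((k : ℝ) + 1) - 1 / (((k + 1 : ℕ) : ℝ) + 1) := by
      push_cast
      rw [div_sub_div _ _ (by positivity) (by positivity),
        div_le_div_iff₀ (by positivity) (by positivity)]
      nlinarith [(Nat.cast_nonneg k : (0 : ℝ) ≤ k)]
    linarith

/-- A bound by `A^k (k+1)^{-s}` for the coefficients of `t^k`, `k < N`, of `x^q f`. -/
def TBound (σ R A : ℝ) (M s q N b : ℕ) (C : ℝ) (f : MvPowerSeries (Fin 2) ℂ) : Prop :=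
  ∀ k < N, RowBound σ R (C * R ^ q * A ^ k / ((k : ℝ) + 1) ^ s) (M * k + b)
    (PowerSeries.X ^ q * row f k)

theorem sum_antidiagonal_inv_le (k s : ℕ) :
    ∑ a ∈ HasAntidiagonal.antidiagonal k,
      (if a.2 ≤ a.1 then 1 / (((a.1 : ℝ) + 1) ^ s * ((a.2 : ℝ) + 1) ^ 2)
        else 1 / (((a.1 : ℝ) + 1) ^ 2 * ((a.2 : ℝ) + 1) ^ s)) ≤
      2 ^ (s + 2) / ((k : ℝ) + 1) ^ s := by
  have h1 : ∀ a ∈ HasAntidiagonal.antidiagonal k,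
      (if a.2 ≤ a.1 then 1 / (((a.1 : ℝ) + 1) ^ s * ((a.2 : ℝ) + 1) ^ 2)
        else 1 / (((a.1 : ℝ) + 1) ^ 2 * ((a.2 : ℝ) + 1) ^ s)) ≤
      2 ^ s / ((k : ℝ) + 1) ^ s * (1 / ((a.1 : ℝ) + 1) ^ 2 + 1 / ((a.2 : ℝ) + 1) ^ 2) := by
    intro a ha
    have ha := HasAntidiagonal.mem_antidiagonal.1 ha
    have hak : (k : ℝ) = a.1 + a.2 := by exact_mod_cast ha.symm
    have key : ∀ x : ℝ, 0 ≤ x → (k : ℝ) ≤ 2 * x → 1 / (x + 1) ^ s ≤ 2 ^ s / ((k : ℝ) + 1) ^ s := by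
      intro x hx hkx
      rw [div_le_div_iff₀ (by positivity) (by positivity), one_mul, ← mul_pow]
      gcongr
      linarith
    have p1 : 0 ≤ 1 / ((a.1 : ℝ) + 1) ^ 2 := by positivity
    have p2 : 0 ≤ 1 / ((a.2 : ℝ) + 1) ^ 2 := by positivity
    have p3 : 0 ≤ 2 ^ s / ((k : ℝ) + 1) ^ s := by positivity
    split_ifs with h
    · have h : (a.2 : ℝ) ≤ a.1 := by exact_mod_cast h
      rw [← one_div_mul_one_div]
      exact mul_le_mul (key _ (by positivity) (by linarith)) (by linarith) p2 p3
    · have h : (a.1 : ℝ) ≤ a.2 := by exact_mod_cast (not_le.1 h).le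
      rw [← one_div_mul_one_div, mul_comm]
      exact mul_le_mul (key _ (by positivity) (by linarith)) (by linarith) p1 p3
  refine (Finset.sum_le_sum h1).trans ?_
  have h2 : ∑ a ∈ HasAntidiagonal.antidiagonal k, 1 / ((a.1 : ℝ) + 1) ^ 2 ≤ 2 := by
    rw [Finset.Nat.sum_antidiagonal_eq_sum_range_succ_mk]
    exact (sum_range_one_div_sq_le k).trans (sub_le_self _ (by positivity))
  have h3 : ∑ a ∈ HasAntidiagonal.antidiagonal k, 1 / ((a.2 : ℝ) + 1) ^ 2 ≤ 2 := by
    rw [← Finset.Nat.sum_antidiagonal_swap]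
    exact h2
  rw [← Finset.mul_sum, Finset.sum_add_distrib]
  calc _ ≤ 2 ^ s / ((k : ℝ) + 1) ^ s * (2 + 2) := by gcongr
    _ = _ := by ring

theorem TBound.mul (hσ : 1 ≤ σ) (hR : 0 < R) {A : ℝ} (hA : 0 < A) {M s q N b b' : ℕ}
    {C C' : ℝ} {f g : MvPowerSeries (Fin 2) ℂ} (hC : 0 ≤ C) (hC' : 0 ≤ C')
    (hf : TBound σ R A M 2 0 N b C f) (hf' : TBound σ R A M s q N b C f)
    (hg : TBound σ R A M 2 0 N b' C' g) (hg' : TBound σ R A M s q N b' C' g) :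
    TBound σ R A M s q N (b + b') (C * C' * 2 ^ (s + 2)) (f * g) := by
  intro k hk
  rw [row_mul, Finset.mul_sum]
  refine RowBound.mono hR (RowBound.sum (C := fun a => C * C' * R ^ q * A ^ k *
      (if a.2 ≤ a.1 then 1 / (((a.1 : ℝ) + 1) ^ s * ((a.2 : ℝ) + 1) ^ 2)
        else 1 / (((a.1 : ℝ) + 1) ^ 2 * ((a.2 : ℝ) + 1) ^ s))) fun a ha => ?_) ?_
  · have ha := HasAntidiagonal.mem_antidiagonal.1 ha
    have hab : M * k + (b + b') = (M * a.1 + b) + (M * a.2 + b') := by rw [← ha]; ring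
    rw [hab]
    split_ifs
    · have h1 := hf' a.1 (by omega)
      have h2 := hg a.2 (by omega)
      rw [pow_zero, pow_zero, one_mul] at h2
      have := RowBound.mul hσ hR (by positivity) (by positivity) h1 h2
      rw [mul_assoc (PowerSeries.X ^ q)] at this
      refine this.mono hR (le_of_eq ?_)
      rw [← ha, pow_add]
      field_simp
    · have h1 := hf a.1 (by omega)
      have h2 := hg' a.2 (by omega)
      rw [pow_zero, pow_zero, one_mul] at h1
      have := RowBound.mul hσ hR (by positivity) (by positivity) h1 h2
      rw [mul_left_comm] at this
      refine this.mono hR (le_of_eq ?_)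
      rw [← ha, pow_add]
      field_simp
  · rw [← Finset.mul_sum]
    refine (mul_le_mul_of_nonneg_left (sum_antidiagonal_inv_le k s) (by positivity)).trans_eq ?_
    ring

/-- The bound which is stable under products of series. -/
structure ProdBound (σ R A : ℝ) (M s q N b : ℕ) (C : ℝ) (f : MvPowerSeries (Fin 2) ℂ) :
    Prop where
  low : TBound σ R A M 2 0 N b (C / 2 ^ (s + 2)) f
  high : TBound σ R A M s q N b (C / 2 ^ (s + 2)) f

theorem TBound.mono (hR : 0 < R) {A : ℝ} (hA : 0 < A) {M s q N b : ℕ} {C C' : ℝ}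
    {f : MvPowerSeries (Fin 2) ℂ} (h : TBound σ R A M s q N b C f) (hC : C ≤ C') :
    TBound σ R A M s q N b C' f := fun k hk => (h k hk).mono hR (by gcongr)

theorem ProdBound.mul (hσ : 1 ≤ σ) (hR : 0 < R) {A : ℝ} (hA : 0 < A) {M s q N b b' : ℕ}
    (hs : 2 ≤ s) {C C' : ℝ} {f g : MvPowerSeries (Fin 2) ℂ} (hC : 0 ≤ C) (hC' : 0 ≤ C')
    (hf : ProdBound σ R A M s q N b C f) (hg : ProdBound σ R A M s q N b' C' g) :
    ProdBound σ R A M s q N (b + b') (C * C') (f * g) := by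
  constructor
  · refine (TBound.mul hσ hR hA (by positivity) (by positivity) hf.low hf.low hg.low
      hg.low).mono hR hA ?_
    calc C / 2 ^ (s + 2) * (C' / 2 ^ (s + 2)) * 2 ^ (2 + 2) ≤
        C / 2 ^ (s + 2) * (C' / 2 ^ (s + 2)) * 2 ^ (s + 2) := by gcongr; norm_num
      _ = _ := by field_simp
  · refine (TBound.mul hσ hR hA (by positivity) (by positivity) hf.low hf.high hg.low
      hg.high).mono hR hA (le_of_eq ?_)
    field_simp

/-- A product of `d` series with the same bound. -/
def PowBound (σ R A : ℝ) (M s q N b : ℕ) (C : ℝ) (d : ℕ) (f : MvPowerSeries (Fin 2) ℂ) : Prop :=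
  (d = 0 ∧ f = 1) ∨ ProdBound σ R A M s q N (d * b) (C ^ d) f

theorem PowBound.mul (hσ : 1 ≤ σ) (hR : 0 < R) {A : ℝ} (hA : 0 < A) {M s q N b : ℕ}
    (hs : 2 ≤ s) {C : ℝ} {d d' : ℕ} {f g : MvPowerSeries (Fin 2) ℂ} (hC : 0 ≤ C)
    (hf : PowBound σ R A M s q N b C d f) (hg : PowBound σ R A M s q N b C d' g) :
    PowBound σ R A M s q N b C (d + d') (f * g) := by
  rcases hf with ⟨rfl, rfl⟩ | hf
  · simpa using hg
  rcases hg with ⟨rfl, rfl⟩ | hg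
  · rw [add_zero, mul_one]; exact Or.inr hf
  right
  rw [add_mul, pow_add]
  exact hf.mul hσ hR hA hs (by positivity) (by positivity) hg

theorem PowBound.pow (hσ : 1 ≤ σ) (hR : 0 < R) {A : ℝ} (hA : 0 < A) {M s q N b : ℕ}
    (hs : 2 ≤ s) {C : ℝ} {f : MvPowerSeries (Fin 2) ℂ} (hC : 0 ≤ C)
    (hf : ProdBound σ R A M s q N b C f) (d : ℕ) :
    PowBound σ R A M s q N b C d (f ^ d) := by
  induction d with
  | zero => exact Or.inl ⟨rfl, pow_zero _⟩
  | succ d ih =>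
    rw [pow_succ]
    exact ih.mul hσ hR hA hs hC (Or.inr (by simpa using hf))

theorem PowBound.prod (hσ : 1 ≤ σ) (hR : 0 < R) {A : ℝ} (hA : 0 < A) {M s q N b : ℕ}
    (hs : 2 ≤ s) {C : ℝ} (hC : 0 ≤ C) {ι : Type*} (t : Finset ι)
    {f : ι → MvPowerSeries (Fin 2) ℂ} (d : ι → ℕ)
    (hf : ∀ i ∈ t, d i ≠ 0 → ProdBound σ R A M s q N b C (f i)) :
    PowBound σ R A M s q N b C (∑ i ∈ t, d i) (∏ i ∈ t, f i ^ d i) := by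
  classical
  induction t using Finset.induction_on with
  | empty => exact Or.inl ⟨rfl, rfl⟩
  | insert a t ha ih =>
    rw [Finset.prod_insert ha, Finset.sum_insert ha]
    refine PowBound.mul hσ hR hA hs hC ?_ (ih fun i hi => hf i (by simp [hi]))
    rcases Nat.eq_zero_or_pos (d a) with h | h
    · exact Or.inl ⟨h, by rw [h, pow_zero]⟩
    · exact PowBound.pow hσ hR hA hs hC (hf a (by simp) h.ne') (d a)

end

end TotChar

namespace TotChar

open Finset

/-! ### The loss of derivatives in the nonlinear terms -/

theorem exists_coeff_iterate_pderiv {ι : Type*} (i : ι) (μ : ℕ) (f : MvPowerSeries ι ℂ)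
    (d : ι →₀ ℕ) :
    ∃ c : ℂ, c ≠ 0 ∧ MvPowerSeries.coeff d ((MvPowerSeries.pderiv ℂ i)^[μ] f) =
      c * MvPowerSeries.coeff (d + Finsupp.single i μ) f := by
  induction μ generalizing d with
  | zero => exact ⟨1, one_ne_zero, by simp⟩
  | succ μ ih =>
    obtain ⟨c, hc, h⟩ := ih (d + Finsupp.single i 1)
    refine ⟨c * ((d i : ℂ) + 1), mul_ne_zero hc (Nat.cast_add_one_ne_zero _), ?_⟩
    rw [Function.iterate_succ_apply', MvPowerSeries.coeff_pderiv, h, add_assoc,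
      ← Finsupp.single_add, add_comm 1 μ]
    ring

theorem mem_indexSetMu {m : ℕ} {F : (Var m → ℂ) → ℂ} {n : Var m → ℕ} (hn : IsRest n)
    (h0 : taylorCoeff F n ≠ 0) {q : {q : ℕ × ℕ // q ∈ indexSet m}} (hq : n (varZ q) ≠ 0)
    (hx : n (varX m) < q.1.2) : q ∈ indexSetMu F (n (varX m)) := by
  refine ⟨hx, fun hzero => ?_⟩
  have hz : n (varZ q) ≤ zDegree n :=
    Finset.single_le_sum (f := fun q => n (varZ q)) (fun _ _ => Nat.zero_le _) (mem_univ q)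
  set d : Var m →₀ ℕ := Finsupp.equivFunOnFinite.symm fun v =>
    if v = varZ q then n v - 1 else if v = varX m then 0 else n v with hd
  have hdx : d (varX m) = 0 := by simp [hd]
  have hdn : d + Finsupp.single (varZ q) 1 + Finsupp.single (varX m) (n (varX m)) =
      Finsupp.equivFunOnFinite.symm n := by
    ext v
    simp only [hd, Finsupp.add_apply, Finsupp.equivFunOnFinite_symm_apply_apply,
      Finsupp.single_apply]
    by_cases h1 : v = varZ q
    · subst h1
      simp
      omega
    · by_cases h2 : v = varX m
      · subst h2; simp
      · rw [if_neg h1, if_neg h2, if_neg (Ne.symm h1), if_neg (Ne.symm h2)]; simp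
  have h1 := congrArg (MvPowerSeries.coeff d) hzero
  obtain ⟨c, hc, h2⟩ := exists_coeff_iterate_pderiv (varX m) (n (varX m)) (nonlinearPart F)
    (d + Finsupp.single (varZ q) 1)
  rw [MvPowerSeries.coeff_apply, restrictX, if_pos hdx, MvPowerSeries.coeff_pderiv, h2, hdn,
    map_zero] at h1
  have h3 : MvPowerSeries.coeff (Finsupp.equivFunOnFinite.symm n) (nonlinearPart F) =
      taylorCoeff F n := by
    rw [MvPowerSeries.coeff_apply, nonlinearPart, if_pos, taylorCoeff]
    simp only [Finsupp.equivFunOnFinite_symm_apply_apply]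
    change 2 ≤ n (varT m) + zDegree n
    rcases hn with hn | hn <;> omega
  rw [h3] at h1
  exact mul_ne_zero (mul_ne_zero hc h0) (Nat.cast_add_one_ne_zero _) h1

theorem lossExponent_nonneg {σ : ℝ} (hσ : 1 ≤ σ) (q α : ℕ) : 0 ≤ lossExponent σ q α := by
  unfold lossExponent
  split_ifs with h
  · have : (q : ℝ) ≤ α := by exact_mod_cast h.le
    have : 0 ≤ σ * ((α : ℝ) - q) := mul_nonneg (by linarith) (by linarith)
    positivity
  · positivity

theorem lossExponent_le {σ : ℝ} (hσ : 1 ≤ σ) (q α : ℕ) : lossExponent σ q α ≤ σ * α := by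
  unfold lossExponent
  have hq : (0 : ℝ) ≤ q := Nat.cast_nonneg q
  have hα : (0 : ℝ) ≤ α := Nat.cast_nonneg α
  split_ifs with h
  · nlinarith
  · nlinarith

theorem add_lossExponent_le {m : ℕ} {F : (Var m → ℂ) → ℂ}
    (hσ : ∀ mu : ℕ, mu < m → ∀ q ∈ indexSetMu F mu,
      irregularity F ≤ ((m : ℝ) - q.1.1 - mu) / ((q.1.2 : ℝ) - mu))
    {n : Var m → ℕ} (hn : IsRest n) (h0 : taylorCoeff F n ≠ 0)
    {q : {q : ℕ × ℕ // q ∈ indexSet m}} (hq : n (varZ q) ≠ 0) :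
    (q.1.1 : ℝ) + lossExponent (irregularity F) (n (varX m)) q.1.2 ≤ m := by
  have hI := mem_indexSet.1 q.2
  unfold lossExponent
  split_ifs with hx
  · have h1 := hσ (n (varX m)) (by omega) q (mem_indexSetMu hn h0 hq hx)
    have h2 : (0 : ℝ) < (q.1.2 : ℝ) - n (varX m) := sub_pos.2 (by exact_mod_cast hx)
    rw [le_div_iff₀ h2] at h1
    linarith
  · exact_mod_cast hI.1

/-- The bound for the first `N` coefficients of `u / t` in the induction. -/
def SolutionBound (σ R A ε : ℝ) (m S N : ℕ) (u : MvPowerSeries (Fin 2) ℂ) : Prop :=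
  ∀ k < N, RowBound σ R (ε * A ^ k / ((k : ℝ) + 1) ^ S) (3 * m * k + m) (row u (k + 1))

section

variable {σ R A ε : ℝ} {m : ℕ} {u : MvPowerSeries (Fin 2) ℂ}

theorem SolutionBound.tBound_jet (hσ : 1 ≤ σ) (hm : 1 ≤ m) (hR : 0 < R) (hR1 : R ≤ 1)
    (hA : 0 < A) (hε : 0 ≤ ε) {S N : ℕ} (hu : SolutionBound σ R A ε m S N u)
    (q : {q : ℕ × ℕ // q ∈ indexSet m}) {x T J s : ℕ}
    (hT : lossExponent σ x q.1.2 ≤ T) (hJ : (q.1.1 : ℝ) + lossExponent σ x q.1.2 ≤ J)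
    (hS : J + s = S) :
    TBound σ R A (3 * m) s x N (2 * m) (ε * (3 * m) ^ T / R ^ m)
      (shiftT (jet m u (varZ q))) := by
  intro k hk l
  obtain ⟨⟨j, α⟩, hI⟩ := q
  have hI' := mem_indexSet.1 hI
  simp only at hT hJ hI'
  rw [PowerSeries.coeff_X_pow_mul']
  have hθ := theta_nonneg σ (3 * m * k + 2 * m) l
  have hθ' := theta_nonneg σ (3 * m * k + m) (l - x + α)
  have hm0 : (1 : ℝ) ≤ m := by exact_mod_cast hm
  split_ifs with hx
  swap
  · rw [norm_zero]; positivity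
  rw [coeff_row, shiftT, coeffTX_ofCoeff, coeffTX_jet_inr]
  simp only
  have h1 := hu k hk (l - x + α)
  rw [coeff_row] at h1
  have h2 := descFactorial_mul_theta_shift_le hσ (a := 3 * m * k + m) (by omega) hx α
  set e := lossExponent σ x α with he
  have he0 : 0 ≤ e := lossExponent_nonneg hσ x α
  have hk1 : (1 : ℝ) ≤ (k : ℝ) + 1 := by linarith [(Nat.cast_nonneg k : (0 : ℝ) ≤ k)]
  have hbase : ((3 * m * k + m : ℕ) : ℝ) + α ≤ 3 * m * ((k : ℝ) + 1) := by
    have : (α : ℝ) ≤ m := by exact_mod_cast (by omega : α ≤ m)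
    push_cast
    linarith
  have h3 : (((3 * m * k + m : ℕ) : ℝ) + α) ^ e ≤ (3 * m : ℝ) ^ T * ((k : ℝ) + 1) ^ e := by
    refine (Real.rpow_le_rpow (by positivity) hbase he0).trans ?_
    rw [Real.mul_rpow (by positivity) (by positivity), ← Real.rpow_natCast (3 * m : ℝ) T]
    gcongr
    linarith
  have h4 : theta σ (3 * m * k + m + α) l ≤ theta σ (3 * m * k + 2 * m) l :=
    theta_mono_left hσ (by omega) l
  have h5 : ((k : ℝ) + 1) ^ j * ((k : ℝ) + 1) ^ e ≤ ((k : ℝ) + 1) ^ J := by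
    rw [← Real.rpow_natCast _ j, ← Real.rpow_natCast _ J, ← Real.rpow_add (by positivity)]
    exact Real.rpow_le_rpow_of_exponent_le hk1 hJ
  have h6 : R ^ l * R ^ m ≤ R ^ x * R ^ (l - x + α) := by
    rw [← pow_add, ← pow_add]
    exact pow_le_pow_of_le_one hR.le hR1 (by omega)
  have h7 : 1 / R ^ (l - x + α) ≤ R ^ x / (R ^ l * R ^ m) := by
    rw [div_le_div_iff₀ (by positivity) (by positivity), one_mul]; exact h6
  have hk2 : ‖((k + 1 : ℕ) : ℂ)‖ = (k : ℝ) + 1 := by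
    rw [Complex.norm_natCast]; push_cast; ring
  rw [norm_mul, norm_mul, norm_pow, hk2, Complex.norm_natCast]
  calc ((k : ℝ) + 1) ^ j * (((l - x + α).descFactorial α : ℝ) * ‖coeffTX u (k + 1) (l - x + α)‖)
      ≤ ((k : ℝ) + 1) ^ j * (((l - x + α).descFactorial α : ℝ) * (ε * A ^ k / ((k : ℝ) + 1) ^ S *
          theta σ (3 * m * k + m) (l - x + α) / R ^ (l - x + α))) := by gcongr
    _ = ε * A ^ k / ((k : ℝ) + 1) ^ S * (1 / R ^ (l - x + α)) * (((k : ℝ) + 1) ^ j *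
          (((l - x + α).descFactorial α : ℝ) * theta σ (3 * m * k + m) (l - x + α))) := by ring
    _ ≤ ε * A ^ k / ((k : ℝ) + 1) ^ S * (R ^ x / (R ^ l * R ^ m)) * (((k : ℝ) + 1) ^ j *
          (((3 * m : ℝ) ^ T * ((k : ℝ) + 1) ^ e) * theta σ (3 * m * k + 2 * m) l)) := by
        exact mul_le_mul (mul_le_mul_of_nonneg_left h7 (by positivity))
          (mul_le_mul_of_nonneg_left (h2.trans
            (mul_le_mul h3 h4 (theta_nonneg _ _ _) (by positivity))) (by positivity))
          (by positivity) (by positivity)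
    _ = ε * A ^ k / ((k : ℝ) + 1) ^ S * (R ^ x / (R ^ l * R ^ m)) *
          ((((k : ℝ) + 1) ^ j * ((k : ℝ) + 1) ^ e) *
          ((3 * m : ℝ) ^ T * theta σ (3 * m * k + 2 * m) l)) := by ring
    _ ≤ ε * A ^ k / ((k : ℝ) + 1) ^ S * (R ^ x / (R ^ l * R ^ m)) *
          (((k : ℝ) + 1) ^ J * ((3 * m : ℝ) ^ T * theta σ (3 * m * k + 2 * m) l)) := by gcongr
    _ = _ := by
        rw [← hS, pow_add]
        field_simp

theorem norm_coeffTX_prod_jet_pow_le (hσ : 1 ≤ σ) (hm : 1 ≤ m) (hR : 0 < R) (hR1 : R ≤ 1)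
    (hA : 0 < A) (hε : 0 ≤ ε) {T₀ p k : ℕ} (hT₀ : σ * m ≤ T₀) (hp : p = T₀ + 2)
    (hu0 : ∀ l, coeffTX u 0 l = 0) (hu : SolutionBound σ R A ε m (p + m) k u)
    {n : Var m → ℕ} (hn : IsRest n)
    (hloss : ∀ q, n (varZ q) ≠ 0 → (q.1.1 : ℝ) + lossExponent σ (n (varX m)) q.1.2 ≤ m)
    (l : ℕ) :
    ‖coeffTX (∏ v, jet m u v ^ n v) (k + 1) l‖ ≤
      (ε * (3 * m) ^ T₀ / R ^ m * 2 ^ (p + 2)) ^ zDegree n * R ^ n (varX m) *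
      (A ^ (k + 1) / A ^ (n (varT m) + zDegree n)) *
      ((n (varT m) + zDegree n : ℕ) : ℝ) ^ p / ((k : ℝ) + 1) ^ p *
      theta σ (3 * m * k + m) l / R ^ l := by
  set C : ℝ := ε * (3 * m) ^ T₀ / R ^ m * 2 ^ (p + 2) with hC
  have hC0 : 0 ≤ C := by positivity
  have hθ := theta_nonneg σ (3 * m * k + m) l
  have hall : ∀ q : {q : ℕ × ℕ // q ∈ indexSet m}, ∀ x,
      lossExponent σ x q.1.2 ≤ T₀ := fun q x => by
    have h1 := lossExponent_le hσ x q.1.2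
    have h2 : (q.1.2 : ℝ) ≤ m := by
      have := mem_indexSet.1 q.2
      exact_mod_cast (by omega : q.1.2 ≤ m)
    have : σ * q.1.2 ≤ σ * m := by gcongr
    linarith
  have hpow : PowBound σ R A (3 * m) p (n (varX m)) k (2 * m) C (zDegree n) (zMonomial u n) := by
    refine PowBound.prod hσ hR hA (by omega) hC0 _ _ fun q _ hq => ⟨?_, ?_⟩
    · have : C / 2 ^ (p + 2) = ε * (3 * m) ^ T₀ / R ^ m := by rw [hC]; field_simp
      rw [this]
      refine hu.tBound_jet hσ hm hR hR1 hA hε q (J := T₀ + m) (hall q 0) ?_ (by omega)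
      have h1 : (q.1.1 : ℝ) ≤ m := by
        have := mem_indexSet.1 q.2
        exact_mod_cast (by omega : q.1.1 ≤ m)
      push_cast
      linarith [hall q 0]
    · have : C / 2 ^ (p + 2) = ε * (3 * m) ^ T₀ / R ^ m := by rw [hC]; field_simp
      rw [this]
      exact hu.tBound_jet hσ hm hR hR1 hA hε q (J := m) (hall q _) (hloss q hq) (by omega)
  set d := n (varT m) + zDegree n with hd
  have hd1 : 1 ≤ d := by rcases hn with hn | hn <;> omega
  rw [coeffTX_prod_jet_pow hu0]
  split_ifs with h1 h2
  · rw [norm_zero]; positivity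
  · rw [norm_zero]; positivity
  · have hkd : (k : ℝ) + 1 = ((k + 1 - d : ℕ) : ℝ) + d := by
      have : k + 1 = (k + 1 - d) + d := by omega
      exact_mod_cast this
    have hd1' : (1 : ℝ) ≤ d := by exact_mod_cast hd1
    by_cases hz : zDegree n = 0
    · have h4 : ∀ q, n (varZ q) = 0 := fun q => Finset.sum_eq_zero_iff.1 hz q (mem_univ q)
      have h1z : zMonomial u n = 1 := by simp [zMonomial, h4]
      rw [h1z, coeffTX_one]
      split_ifs with h3
      · have hk : k + 1 = d := by omega
        have hl : l = n (varX m) := by omega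
        have hkd' : (k : ℝ) + 1 = d := by exact_mod_cast hk
        have hθ1 := one_le_theta hσ (a := 3 * m * k + m) (by omega) l
        rw [hz, pow_zero, ← hl, hk, div_self (by positivity), hkd', norm_one]
        have : (d : ℝ) ^ p ≠ 0 := by positivity
        field_simp
        exact hθ1
      · rw [norm_zero]; positivity
    · have hd2 : 2 ≤ d := by rcases hn with hn | hn <;> omega
      replace hpow := hpow.resolve_left fun h => hz h.1
      have h3 := hpow.high (k + 1 - d) (by omega) l
      rw [PowerSeries.coeff_X_pow_mul', if_pos (by omega), coeff_row] at h3
      refine h3.trans ?_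
      have h4 : theta σ (3 * m * (k + 1 - d) + zDegree n * (2 * m)) l ≤
          theta σ (3 * m * k + m) l := by
        refine theta_mono_left hσ ?_ l
        have h5 : m * (3 * (k + 1 - d) + 2 * zDegree n) ≤ m * (3 * k + 1) :=
          Nat.mul_le_mul_left _ (by rcases hn with hn | hn <;> omega)
        calc _ = m * (3 * (k + 1 - d) + 2 * zDegree n) := by ring
          _ ≤ _ := h5
          _ = _ := by ring
      have h6 : A ^ (k + 1) / A ^ d = A ^ (k + 1 - d) := by
        rw [div_eq_iff (by positivity), ← pow_add]; congr 1; omega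
      have h7 : 1 / (((k + 1 - d : ℕ) : ℝ) + 1) ^ p ≤ (d : ℝ) ^ p / ((k : ℝ) + 1) ^ p := by
        rw [div_le_div_iff₀ (by positivity) (by positivity), one_mul, ← mul_pow]
        have : (0 : ℝ) ≤ ((k + 1 - d : ℕ) : ℝ) := Nat.cast_nonneg _
        gcongr
        rw [hkd]
        nlinarith
      have h8 : C ^ zDegree n / 2 ^ (p + 2) ≤ C ^ zDegree n :=
        div_le_self (by positivity) (one_le_pow₀ (by norm_num))
      have hθ' := theta_nonneg σ (3 * m * (k + 1 - d) + zDegree n * (2 * m)) l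
      rw [h6]
      calc _ = C ^ zDegree n / 2 ^ (p + 2) * R ^ n (varX m) * A ^ (k + 1 - d) *
            (1 / (((k + 1 - d : ℕ) : ℝ) + 1) ^ p) *
            theta σ (3 * m * (k + 1 - d) + zDegree n * (2 * m)) l / R ^ l := by ring
        _ ≤ C ^ zDegree n * R ^ n (varX m) * A ^ (k + 1 - d) *
            ((d : ℝ) ^ p / ((k : ℝ) + 1) ^ p) * theta σ (3 * m * k + m) l / R ^ l := by gcongr
        _ = _ := by ring

end

end TotChar

namespace TotChar

open Finset

/-! ### The estimate of the formal solution -/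

theorem sum_box_half_pow_le (m N : ℕ) :
    ∑ n ∈ box m N, (1 / 2 : ℝ) ^ (∑ v, n v) ≤ 2 ^ Fintype.card (Var m) := by
  have h1 : ∑ n ∈ box m N, (1 / 2 : ℝ) ^ (∑ v, n v) =
      ∏ _v : Var m, ∑ j ∈ range (N + 1), (1 / 2 : ℝ) ^ j := by
    rw [Finset.prod_univ_sum, box]
    exact Finset.sum_congr rfl fun n _ => (Finset.prod_pow_eq_pow_sum _ _ _).symm
  rw [h1]
  refine (Finset.prod_le_prod (fun _ _ => Finset.sum_nonneg fun _ _ => by positivity)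
    fun _ _ => sum_geometric_two_le _).trans_eq ?_
  rw [Finset.prod_const, Finset.card_univ]

theorem sum_exponents {m : ℕ} (n : Var m → ℕ) :
    ∑ v, n v = n (varT m) + n (varX m) + zDegree n := by
  rw [Fintype.sum_sum_type, Fin.sum_univ_two]; rfl

theorem exists_pow_le_mul_two_pow (p : ℕ) : ∃ P : ℝ, 0 < P ∧ ∀ d : ℕ, (d : ℝ) ^ p ≤ P * 2 ^ d := by
  obtain ⟨P, hP⟩ := (tendsto_pow_const_div_const_pow_of_one_lt p
    (one_lt_two : (1 : ℝ) < 2)).bddAbove_range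
  refine ⟨max P 1, by positivity, fun d => ?_⟩
  have := (hP ⟨d, rfl⟩).trans (le_max_left P 1)
  rwa [div_le_iff₀ (by positivity)] at this

theorem monomial_weight_le {A C ρ Y : ℝ} (hA : 0 < A) (hC : 0 ≤ C) (hρ : 0 < ρ)
    (hY : 2 * ρ ≤ Y) (hCY : 2 * ρ * C ≤ Y) (hA1 : 2 * Y ≤ A) (hA2 : 4 * Y ^ 2 ≤ A) {i z : ℕ}
    (h : 1 ≤ i ∨ 2 ≤ z) :
    C ^ z * (2 * ρ) ^ (i + z) * (A / A ^ (i + z)) ≤ (4 * ρ + 1) * (1 / 2) ^ (i + z) := by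
  have hY0 : 0 < Y := by linarith
  by_cases h1 : i = 1 ∧ z = 0
  · obtain ⟨rfl, rfl⟩ := h1
    simp only [pow_zero, one_mul, add_zero, pow_one, div_self hA.ne', mul_one]
    linarith
  · have hd : 2 ≤ i + z := by omega
    have h2 : C ^ z * (2 * ρ) ^ (i + z) ≤ Y ^ (i + z) := by
      rw [pow_add, pow_add, mul_left_comm, ← mul_pow, mul_comm C]
      gcongr
    have h3 : (2 * Y / A) ^ (i + z) ≤ (2 * Y / A) ^ 2 :=
      pow_le_pow_of_le_one (by positivity) ((div_le_one hA).2 hA1) hd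
    have h4 : A * (2 * Y / A) ^ 2 ≤ 1 := by
      rw [div_pow, ← mul_div_assoc, div_le_one (by positivity)]
      nlinarith
    calc C ^ z * (2 * ρ) ^ (i + z) * (A / A ^ (i + z)) ≤ Y ^ (i + z) * (A / A ^ (i + z)) := by
          gcongr
      _ = A * (2 * Y / A) ^ (i + z) * (1 / 2) ^ (i + z) := by
          rw [div_pow, mul_pow, div_pow, one_pow]; field_simp
      _ ≤ A * (2 * Y / A) ^ 2 * (1 / 2) ^ (i + z) := by gcongr
      _ ≤ (4 * ρ + 1) * (1 / 2) ^ (i + z) := by gcongr; linarith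

section

variable {σ R A ε K ρ : ℝ} {m : ℕ} {F : (Var m → ℂ) → ℂ} {u : MvPowerSeries (Fin 2) ℂ}

theorem norm_rest_le (hσ : 1 ≤ σ) (hm : 1 ≤ m) (hR : 0 < R) (hR1 : R ≤ 1)
    (hA : 0 < A) (hε : 0 ≤ ε) {T₀ p k : ℕ} (hT₀ : σ * m ≤ T₀) (hp : p = T₀ + 2)
    (hu0 : ∀ l, coeffTX u 0 l = 0) (hu : SolutionBound σ R A ε m (p + m) k u)
    (hloss : ∀ n : Var m → ℕ, IsRest n → taylorCoeff F n ≠ 0 → ∀ q, n (varZ q) ≠ 0 →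
      (q.1.1 : ℝ) + lossExponent σ (n (varX m)) q.1.2 ≤ m)
    (hK : 0 < K) (hρ : 0 < ρ) (hF : ∀ n, ‖taylorCoeff F n‖ ≤ K * ρ ^ (∑ v, n v))
    (hρR : ρ * R ≤ 1 / 2) {P : ℝ} (hP : 0 < P) (hP' : ∀ d : ℕ, (d : ℝ) ^ p ≤ P * 2 ^ d)
    {Y : ℝ} (hY : 2 * ρ ≤ Y) (hCY : 2 * ρ * (ε * (3 * m) ^ T₀ / R ^ m * 2 ^ (p + 2)) ≤ Y)
    (hA1 : 2 * Y ≤ A) (hA2 : 4 * Y ^ 2 ≤ A) (l : ℕ) :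
    ‖rest F u (k + 1) l‖ ≤ K * P * (4 * ρ + 1) * 2 ^ Fintype.card (Var m) *
      (A ^ k / ((k : ℝ) + 1) ^ p * theta σ (3 * m * k + m) l / R ^ l) := by
  set C : ℝ := ε * (3 * m) ^ T₀ / R ^ m * 2 ^ (p + 2) with hC
  have hC0 : 0 ≤ C := by positivity
  have hθ := theta_nonneg σ (3 * m * k + m) l
  set V : ℝ := A ^ k / ((k : ℝ) + 1) ^ p * theta σ (3 * m * k + m) l / R ^ l with hV
  have hV0 : 0 ≤ V := by positivity
  have hterm : ∀ n ∈ (box m (k + 1 + l)).filter IsRest,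
      ‖taylorCoeff F n * coeffTX (∏ v, jet m u v ^ n v) (k + 1) l‖ ≤
        K * P * (4 * ρ + 1) * V * (1 / 2) ^ (∑ v, n v) := by
    intro n hn
    have hn := (mem_filter.1 hn).2
    by_cases h0 : taylorCoeff F n = 0
    · rw [h0, zero_mul, norm_zero]; positivity
    have h1 := norm_coeffTX_prod_jet_pow_le hσ hm hR hR1 hA hε hT₀ hp hu0 hu hn
      (hloss n hn h0) l
    rw [← hC] at h1
    have h2 := hF n
    have h3 := monomial_weight_le hA hC0 hρ hY hCY hA1 hA2 hn
    have h4 := hP' (n (varT m) + zDegree n)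
    rw [sum_exponents] at h2 ⊢
    rw [norm_mul]
    calc _ ≤ K * ρ ^ (n (varT m) + n (varX m) + zDegree n) * (C ^ zDegree n * R ^ n (varX m) *
          (A ^ (k + 1) / A ^ (n (varT m) + zDegree n)) *
          ((n (varT m) + zDegree n : ℕ) : ℝ) ^ p / ((k : ℝ) + 1) ^ p *
          theta σ (3 * m * k + m) l / R ^ l) :=
          mul_le_mul h2 h1 (norm_nonneg _) (by positivity)
      _ ≤ K * ρ ^ (n (varT m) + n (varX m) + zDegree n) * (C ^ zDegree n * R ^ n (varX m) *
          (A ^ (k + 1) / A ^ (n (varT m) + zDegree n)) *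
          (P * 2 ^ (n (varT m) + zDegree n)) / ((k : ℝ) + 1) ^ p *
          theta σ (3 * m * k + m) l / R ^ l) := by gcongr
      _ = K * P * V * (C ^ zDegree n * (2 * ρ) ^ (n (varT m) + zDegree n) *
          (A / A ^ (n (varT m) + zDegree n))) * (ρ * R) ^ n (varX m) := by
          rw [hV]; ring
      _ ≤ K * P * V * ((4 * ρ + 1) * (1 / 2) ^ (n (varT m) + zDegree n)) *
          (1 / 2) ^ n (varX m) := by gcongr
      _ = _ := by ring
  refine (norm_sum_le_of_le _ hterm).trans ?_
  rw [← Finset.mul_sum]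
  calc _ ≤ K * P * (4 * ρ + 1) * V * 2 ^ Fintype.card (Var m) := by
        gcongr
        exact (Finset.sum_le_sum_of_subset_of_nonneg (Finset.filter_subset _ _)
          fun _ _ _ => by positivity).trans (sum_box_half_pow_le m _)
    _ = _ := by ring

theorem norm_coeff_coeffC_le (hK : 0 < K) (hρ : 1 ≤ ρ)
    (hF : ∀ n : Var m → ℕ, ‖taylorCoeff F n‖ ≤ K * ρ ^ (∑ v, n v)) {q : ℕ × ℕ}
    (hq : q ∈ indexSet m) (p : ℕ) :
    ‖PowerSeries.coeff p (coeffC F q)‖ ≤ K * ρ ^ (m + 1) * ρ ^ p := by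
  have h := coeff_coeffC F ⟨q, hq⟩ p
  simp only at h
  rw [h, ← taylorCoeff_linExponent, mul_assoc, ← pow_add]
  refine (hF _).trans ?_
  rw [sum_exponents, linExponent_varT, linExponent_varX, zDegree_linExponent]
  have := mem_indexSet.1 hq
  exact mul_le_mul_of_nonneg_left (pow_le_pow_right₀ hρ (by omega)) hK.le

theorem sum_norm_linTerm_le (hσ : irregularity F = σ) (hR : 0 < R) (hρ : 1 ≤ ρ) (hK : 0 < K)
    (hF : ∀ n : Var m → ℕ, ‖taylorCoeff F n‖ ≤ K * ρ ^ (∑ v, n v)) (hρR : ρ * R ≤ 1 / 2)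
    {C : ℝ} (hC : 0 < C)
    (hL : ∀ q ∈ indexSet m, ∀ k l p : ℕ, 1 ≤ k → 1 ≤ p → p ≤ l →
        PowerSeries.coeff p (coeffC F q) ≠ 0 →
        mono k l q ≤ C * ‖indicial F k l‖ * (l.descFactorial p : ℝ) ^ (σ - 1))
    (hsmall : (indexSet m).card * (K * ρ ^ (m + 1) * C * (2 * (ρ * R))) ≤ 1 / 2)
    {k l a : ℕ} (hk : 1 ≤ k) (ha : 1 ≤ a) {E : ℝ} (hE : 0 ≤ E)
    (hu : ∀ l' < l, ‖coeffTX u k l'‖ ≤ E * theta σ a l' / R ^ l') :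
    ‖∑ q ∈ indexSet m, ∑ p ∈ Ico 1 (l + 1), linTerm F u k l q p‖ ≤
      1 / 2 * (‖indicial F k l‖ * (E * theta σ a l / R ^ l)) := by
  have hσ1 : 1 ≤ σ := hσ ▸ one_le_irregularity F
  have hθ := theta_nonneg σ a l
  set W : ℝ := ‖indicial F k l‖ * (E * theta σ a l / R ^ l) with hW
  have hW0 : 0 ≤ W := by positivity
  have hterm : ∀ q ∈ indexSet m, ∀ p ∈ Ico 1 (l + 1),
      ‖linTerm F u k l q p‖ ≤ K * ρ ^ (m + 1) * C * W * (ρ * R) ^ p := by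
    intro q hq p hp
    rw [mem_Ico] at hp
    rw [linTerm]
    by_cases h0 : PowerSeries.coeff p (coeffC F q) = 0
    · rw [h0, zero_mul, norm_zero]; positivity
    have h1 := hL q hq k l p hk hp.1 (by omega) h0
    have h2 := norm_coeff_coeffC_le hK hρ hF hq p
    have h3 := hu (l - p) (by omega)
    have h4 := theta_mul_descFactorial_le hσ1 ha (by omega : p ≤ l)
    have hθ' := theta_nonneg σ a (l - p)
    have h5 : ((l - p).descFactorial q.2 : ℝ) ≤ (l : ℝ) ^ q.2 := by
      exact_mod_cast (Nat.descFactorial_le_pow (l - p) q.2).trans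
        (Nat.pow_le_pow_left (Nat.sub_le l p) _)
    have h6 : R ^ l = R ^ (l - p) * R ^ p := by rw [← pow_add]; congr 1; omega
    rw [norm_mul, norm_mul, norm_mul, norm_pow, Complex.norm_natCast, Complex.norm_natCast]
    have hD : 0 ≤ (l.descFactorial p : ℝ) ^ (σ - 1) := by positivity
    have h7 : (k : ℝ) ^ q.1 * (((l - p).descFactorial q.2 : ℝ) * ‖coeffTX u k (l - p)‖) ≤
        C * W * R ^ p := by
      calc _ ≤ (k : ℝ) ^ q.1 * ((l : ℝ) ^ q.2 * (E * theta σ a (l - p) / R ^ (l - p))) := by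
            gcongr
        _ = mono k l q * (E * theta σ a (l - p) / R ^ (l - p)) := by rw [mono]; ring
        _ ≤ C * ‖indicial F k l‖ * (l.descFactorial p : ℝ) ^ (σ - 1) *
            (E * theta σ a (l - p) / R ^ (l - p)) :=
            mul_le_mul_of_nonneg_right h1 (by positivity)
        _ = C * ‖indicial F k l‖ * E / R ^ (l - p) *
            (theta σ a (l - p) * (l.descFactorial p : ℝ) ^ (σ - 1)) := by ring
        _ ≤ C * ‖indicial F k l‖ * E / R ^ (l - p) * theta σ a l :=
            mul_le_mul_of_nonneg_left h4 (by positivity)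
        _ = _ := by rw [hW, h6]; field_simp
    calc _ ≤ K * ρ ^ (m + 1) * ρ ^ p * (C * W * R ^ p) :=
          mul_le_mul h2 h7 (by positivity) (by positivity)
      _ = _ := by ring
  have hgeom : ∑ p ∈ Ico 1 (l + 1), (ρ * R) ^ p ≤ 2 * (ρ * R) := by
    refine (geom_sum_Ico_le_of_lt_one (by positivity) (by linarith)).trans ?_
    rw [pow_one, div_le_iff₀ (by linarith)]
    have : 0 ≤ ρ * R := by positivity
    nlinarith
  calc _ ≤ ∑ q ∈ indexSet m, ∑ p ∈ Ico 1 (l + 1), K * ρ ^ (m + 1) * C * W * (ρ * R) ^ p :=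
        norm_sum_le_of_le _ fun q hq => norm_sum_le_of_le _ (hterm q hq)
    _ = (indexSet m).card * (K * ρ ^ (m + 1) * C * W * ∑ p ∈ Ico 1 (l + 1), (ρ * R) ^ p) := by
        simp only [Finset.sum_const, nsmul_eq_mul, ← Finset.mul_sum]
    _ ≤ (indexSet m).card * (K * ρ ^ (m + 1) * C * W * (2 * (ρ * R))) := by gcongr
    _ = (indexSet m).card * (K * ρ ^ (m + 1) * C * (2 * (ρ * R))) * W := by ring
    _ ≤ _ := by gcongr

theorem solutionBound_of_le (hσF : irregularity F = σ) (hm : 1 ≤ m) (hN : NonResonance F)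
    (hR : 0 < R) (hR1 : R ≤ 1) (hA : 0 < A) (hε : 0 ≤ ε) {T₀ p : ℕ} (hT₀ : σ * m ≤ T₀)
    (hp : p = T₀ + 2) (hu0 : ∀ l, coeffTX u 0 l = 0)
    (hu : ∀ k l : ℕ, 1 ≤ k → indicial F k l * coeffTX u k l = recursionRHS F u k l)
    (hloss : ∀ n : Var m → ℕ, IsRest n → taylorCoeff F n ≠ 0 → ∀ q, n (varZ q) ≠ 0 →
      (q.1.1 : ℝ) + lossExponent σ (n (varX m)) q.1.2 ≤ m)
    (hK : 0 < K) (hρ : 1 ≤ ρ) (hF : ∀ n, ‖taylorCoeff F n‖ ≤ K * ρ ^ (∑ v, n v))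
    (hρR : ρ * R ≤ 1 / 2) {P : ℝ} (hP : 0 < P) (hP' : ∀ d : ℕ, (d : ℝ) ^ p ≤ P * 2 ^ d)
    {Y : ℝ} (hY : 2 * ρ ≤ Y) (hCY : 2 * ρ * (ε * (3 * m) ^ T₀ / R ^ m * 2 ^ (p + 2)) ≤ Y)
    (hA1 : 2 * Y ≤ A) (hA2 : 4 * Y ^ 2 ≤ A) {C : ℝ} (hC : 0 < C)
    (hCm : ∀ k l : ℕ, 1 ≤ k → (k : ℝ) ^ m ≤ C * ‖indicial F k l‖)
    (hL : ∀ q ∈ indexSet m, ∀ k l p : ℕ, 1 ≤ k → 1 ≤ p → p ≤ l →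
        PowerSeries.coeff p (coeffC F q) ≠ 0 →
        mono k l q ≤ C * ‖indicial F k l‖ * (l.descFactorial p : ℝ) ^ (σ - 1))
    (hsmall : (indexSet m).card * (K * ρ ^ (m + 1) * C * (2 * (ρ * R))) ≤ 1 / 2)
    (hεH : 2 * C * (K * P * (4 * ρ + 1) * 2 ^ Fintype.card (Var m)) ≤ ε) (N : ℕ) :
    SolutionBound σ R A ε m (p + m) N u := by
  have hσ1 : 1 ≤ σ := hσF ▸ one_le_irregularity F
  induction N with
  | zero => intro k hk; omega
  | succ N ih =>
    intro k hk
    rcases Nat.lt_succ_iff_lt_or_eq.1 hk with hk | rfl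
    · exact ih k hk
    intro l
    rw [coeff_row]
    induction l using Nat.strong_induction_on with
    | _ l ihl =>
      have hE : 0 ≤ ε * A ^ k / ((k : ℝ) + 1) ^ (p + m) := by positivity
      have hlin := sum_norm_linTerm_le hσF hR hρ hK hF hρR hC hL hsmall
        (k := k + 1) (l := l) (a := 3 * m * k + m) (by omega) (by omega) hE ihl
      have hrest := norm_rest_le hσ1 hm hR hR1 hA hε hT₀ hp hu0 ih hloss hK (by linarith) hF hρR
        hP hP' hY hCY hA1 hA2 l
      have hrec := hu (k + 1) l (by omega)
      have hLpos : 0 < ‖indicial F ((k + 1 : ℕ) : ℂ) l‖ := norm_pos_iff.2 (hN _ _ (by omega))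
      have hθ := theta_nonneg σ (3 * m * k + m) l
      have hLm := hCm (k + 1) l (by omega)
      set Λ := ‖indicial F ((k + 1 : ℕ) : ℂ) l‖ with hΛ
      have hrest' : ‖rest F u (k + 1) l‖ ≤ 1 / 2 * (Λ * (ε * A ^ k /
          ((k : ℝ) + 1) ^ (p + m) * theta σ (3 * m * k + m) l / R ^ l)) := by
        refine hrest.trans ?_
        generalize hH : K * P * (4 * ρ + 1) * 2 ^ Fintype.card (Var m) = H at hεH ⊢
        have hH0 : 0 ≤ H := by rw [← hH]; positivity
        push_cast at hLm
        have h1 : 1 ≤ C * Λ / ((k : ℝ) + 1) ^ m := by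
          rw [le_div_iff₀ (by positivity), one_mul]; exact hLm
        calc _ = H * (A ^ k / ((k : ℝ) + 1) ^ p * theta σ (3 * m * k + m) l / R ^ l) * 1 := by
              ring
          _ ≤ H * (A ^ k / ((k : ℝ) + 1) ^ p * theta σ (3 * m * k + m) l / R ^ l) *
              (C * Λ / ((k : ℝ) + 1) ^ m) := by gcongr
          _ = 1 / 2 * (Λ * (2 * C * H * A ^ k /
              ((k : ℝ) + 1) ^ (p + m) * theta σ (3 * m * k + m) l / R ^ l)) := by
              rw [pow_add _ p]; field_simp
          _ ≤ _ := by gcongr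
      have h2 : Λ * ‖coeffTX u (k + 1) l‖ ≤ Λ * (ε * A ^ k /
          ((k : ℝ) + 1) ^ (p + m) * theta σ (3 * m * k + m) l / R ^ l) := by
        rw [hΛ, ← norm_mul, hrec, recursionRHS]
        refine (norm_add_le _ _).trans ((add_le_add hlin hrest').trans_eq ?_)
        ring
      exact le_of_mul_le_mul_left h2 hLpos

end

theorem exists_solutionBound {m : ℕ} (hm : 1 ≤ m) {F : (Var m → ℂ) → ℂ}
    (hN : NonResonance F) (hGP : GeneralizedPoincare F)
    (hσ : ∀ mu : ℕ, mu < m → ∀ q ∈ indexSetMu F mu,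
      irregularity F ≤ ((m : ℝ) - q.1.1 - mu) / ((q.1.2 : ℝ) - mu))
    (hT : ∃ K ρ : ℝ, 0 < K ∧ 0 < ρ ∧
      ∀ n, ‖MvPowerSeries.coeff n (taylorSeries F)‖ ≤ K * ρ ^ (∑ v, n v))
    {u : MvPowerSeries (Fin 2) ℂ} (hu0 : ∀ l, coeffTX u 0 l = 0)
    (hu : ∀ k l : ℕ, 1 ≤ k → indicial F k l * coeffTX u k l = recursionRHS F u k l) :
    ∃ R A ε : ℝ, ∃ S : ℕ, 0 < R ∧ 0 < A ∧ 0 ≤ ε ∧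
      ∀ N, SolutionBound (irregularity F) R A ε m S N u := by
  obtain ⟨K, ρ₀, hK, hρ₀, hF₀⟩ := hT
  obtain ⟨C, hC, hCm, hCL⟩ := exists_mono_le_indicial_mul hN hGP
  have hσ1 : 1 ≤ irregularity F := one_le_irregularity F
  obtain ⟨ρ, hρ1, hρ₀ρ⟩ : ∃ ρ : ℝ, 1 ≤ ρ ∧ ρ₀ ≤ ρ := ⟨max ρ₀ 1, le_max_right _ _, le_max_left _ _⟩
  have hρ : 0 < ρ := by linarith
  have hF : ∀ n : Var m → ℕ, ‖taylorCoeff F n‖ ≤ K * ρ ^ (∑ v, n v) := fun n => by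
    refine (hF₀ (Finsupp.equivFunOnFinite.symm n)).trans ?_
    simp only [Finsupp.equivFunOnFinite_symm_apply_apply]
    gcongr
  obtain ⟨T₀, hT₀⟩ := exists_nat_ge (irregularity F * m)
  obtain ⟨P, hP, hP'⟩ := exists_pow_le_mul_two_pow (T₀ + 2)
  have hcard0 : 0 ≤ (indexSet m).card * (K * ρ ^ (m + 1) * C * (4 * ρ)) := by positivity
  obtain ⟨B, hB⟩ : ∃ B, B = (indexSet m).card * (K * ρ ^ (m + 1) * C * (4 * ρ)) + 2 * ρ :=
    ⟨_, rfl⟩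
  have hB2 : 2 ≤ B := by linarith
  have hB0 : 0 < B := by linarith
  obtain ⟨R, hRB, hR, hR1⟩ : ∃ R : ℝ, B * R = 1 ∧ 0 < R ∧ R ≤ 1 :=
    ⟨1 / B, by field_simp, by positivity, by rw [div_le_one hB0]; linarith⟩
  have hρR : ρ * R ≤ 1 / 2 := by
    have : 2 * ρ * R ≤ B * R := by gcongr; linarith
    linarith
  have hsmall : (indexSet m).card * (K * ρ ^ (m + 1) * C * (2 * (ρ * R))) ≤ 1 / 2 := by
    have : (indexSet m).card * (K * ρ ^ (m + 1) * C * (4 * ρ)) * R ≤ B * R := by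
      gcongr; linarith
    linarith
  obtain ⟨ε, hε⟩ : ∃ ε, ε = 2 * C * (K * P * (4 * ρ + 1) * 2 ^ Fintype.card (Var m)) := ⟨_, rfl⟩
  have hε0 : 0 ≤ ε := by rw [hε]; positivity
  have hc0 : 0 ≤ ε * (3 * m) ^ T₀ / R ^ m * 2 ^ (T₀ + 2 + 2) := by positivity
  obtain ⟨Y, hY1, hY2⟩ : ∃ Y : ℝ, 2 * ρ ≤ Y ∧
      2 * ρ * (ε * (3 * m) ^ T₀ / R ^ m * 2 ^ (T₀ + 2 + 2)) ≤ Y := ⟨_, le_max_left _ _, le_max_right _ _⟩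
  have hY0 : 0 < Y := by linarith
  refine ⟨R, 2 * Y + 4 * Y ^ 2, ε, T₀ + 2 + m, hR, by positivity, hε0, ?_⟩
  exact solutionBound_of_le rfl hm hN hR hR1 (by positivity) hε0 hT₀ rfl hu0 hu
    (fun n hn h0 q hq => add_lossExponent_le hσ hn h0 hq) hK hρ1 hF hρR hP hP' hY1 hY2
    (by nlinarith) (by linarith) hC hCm hCL hsmall hε.ge

end TotChar

namespace TotChar

open scoped Nat

/-! ### Consequences of the estimate -/

theorem norm_coeffTX_le_of_solutionBound {σ R A ε : ℝ} {m S : ℕ} {u : MvPowerSeries (Fin 2) ℂ}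
    (hσ : 1 ≤ σ) (hR : 0 < R) (hA : 0 < A) (hε : 0 ≤ ε) (hu0 : ∀ l, coeffTX u 0 l = 0)
    (hu : ∀ N, SolutionBound σ R A ε m S N u) :
    ∃ D a b : ℝ, 0 ≤ D ∧ 0 < a ∧ 0 < b ∧
      ∀ k l, ‖coeffTX u k l‖ ≤ D * a ^ k * b ^ l * (l ! : ℝ) ^ (σ - 1) := by
  obtain ⟨Q, hQ⟩ : ∃ Q : ℝ, Q = (2 : ℝ) ^ σ := ⟨_, rfl⟩
  have hQ0 : 0 < Q := by rw [hQ]; positivity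
  have hpow : ∀ n : ℕ, ((2 : ℝ) ^ n) ^ σ = Q ^ n := fun n => by
    rw [hQ, ← Real.rpow_natCast, ← Real.rpow_mul (by norm_num), mul_comm, Real.rpow_mul (by norm_num),
      Real.rpow_natCast]
  refine ⟨ε * Q ^ m, max 1 (A * Q ^ (3 * m)), Q / R, by positivity, by positivity, by positivity,
    fun k l => ?_⟩
  cases k with
  | zero => rw [hu0, norm_zero]; positivity
  | succ k =>
    have h1 := hu (k + 1) k (by omega) l
    rw [coeff_row] at h1
    have h2 := theta_le hσ (3 * m * k + m) l
    rw [hpow] at h2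
    have h3 : (1 : ℝ) ≤ ((k : ℝ) + 1) ^ S :=
      one_le_pow₀ (by linarith [(Nat.cast_nonneg k : (0 : ℝ) ≤ k)])
    have h4 : (A * Q ^ (3 * m)) ^ k ≤ max 1 (A * Q ^ (3 * m)) ^ (k + 1) :=
      (pow_le_pow_left₀ (by positivity) (le_max_right _ _) k).trans
        (pow_le_pow_right₀ (le_max_left _ _) (Nat.le_succ k))
    have h5 := theta_nonneg σ (3 * m * k + m) l
    calc ‖coeffTX u (k + 1) l‖ ≤ ε * A ^ k / ((k : ℝ) + 1) ^ S * theta σ (3 * m * k + m) l / R ^ l := h1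
      _ ≤ ε * A ^ k * (Q ^ (3 * m * k + m + l) * (l ! : ℝ) ^ (σ - 1)) / R ^ l := by
          gcongr
          exact div_le_self (by positivity) h3
      _ = ε * Q ^ m * (A * Q ^ (3 * m)) ^ k * (Q / R) ^ l * (l ! : ℝ) ^ (σ - 1) := by
          rw [pow_add, pow_add, pow_mul, mul_pow, div_pow]; field_simp
      _ ≤ _ := by gcongr

variable {σ D a b : ℝ} {u : MvPowerSeries (Fin 2) ℂ}

theorem mem_gevreyClass_of_le (hD : 0 ≤ D) (ha : 0 < a) (hb : 0 < b)
    (hu : ∀ k l, ‖coeffTX u k l‖ ≤ D * a ^ k * b ^ l * (l ! : ℝ) ^ (σ - 1)) :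
    u ∈ gevreyClass 1 σ := by
  have hball : ∀ᶠ P : ℂ × ℂ in nhds 0, ‖P.1‖ < 1 / (2 * a) ∧ ‖P.2‖ < 1 / (2 * b) := by
    refine ((continuous_fst.norm.tendsto' (0 : ℂ × ℂ) 0 (by simp)).eventually
      (gt_mem_nhds (by positivity))).and ((continuous_snd.norm.tendsto' (0 : ℂ × ℂ) 0 (by simp)).eventually
      (gt_mem_nhds (by positivity)))
  filter_upwards [hball] with P hP
  have hgeo : Summable fun n : ℕ × ℕ => D * ((1 / 2 : ℝ) ^ n.1 * (1 / 2 : ℝ) ^ n.2) :=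
    (summable_geometric_two.mul_of_nonneg summable_geometric_two
      (fun _ => by positivity) (fun _ => by positivity)).mul_left D
  refine Summable.of_norm_bounded hgeo fun n => ?_
  have hl : (0 : ℝ) < (n.2 ! : ℝ) ^ (σ - 1) := by
    have : (0 : ℝ) < n.2 ! := by exact_mod_cast Nat.factorial_pos _
    positivity
  have h1 : a * ‖P.1‖ ≤ 1 / 2 := by
    have := hP.1.le; rw [le_div_iff₀ (by positivity)] at this; linarith
  have h2 : b * ‖P.2‖ ≤ 1 / 2 := by
    have := hP.2.le; rw [le_div_iff₀ (by positivity)] at this; linarith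
  rw [sub_self, Real.rpow_zero, one_mul, norm_mul, norm_mul, norm_div, norm_pow, norm_pow,
    Complex.norm_real, Real.norm_of_nonneg hl.le]
  calc _ ≤ D * a ^ n.1 * b ^ n.2 * (n.2 ! : ℝ) ^ (σ - 1) / (n.2 ! : ℝ) ^ (σ - 1) *
        ‖P.1‖ ^ n.1 * ‖P.2‖ ^ n.2 := by gcongr; exact hu _ _
    _ = D * ((a * ‖P.1‖) ^ n.1 * (b * ‖P.2‖) ^ n.2) := by
        rw [mul_pow, mul_pow]; field_simp
    _ ≤ _ := by gcongr

theorem holomorphicInT_of_le (ha : 0 < a)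
    (hu : ∀ k l, ‖coeffTX u k l‖ ≤ D * a ^ k * b ^ l * (l ! : ℝ) ^ (σ - 1)) :
    HolomorphicInT u := by
  refine ⟨1 / (2 * a), by positivity, fun l t => ∑' k, coeffTX u k l * t ^ k, fun l => ?_⟩
  have hsum : Summable fun k : ℕ => ‖D * b ^ l * (l ! : ℝ) ^ (σ - 1)‖ * (1 / 2 : ℝ) ^ k :=
    summable_geometric_two.mul_left _
  have hle : ∀ k : ℕ, ∀ t ∈ Metric.ball (0 : ℂ) (1 / (2 * a)),
      ‖coeffTX u k l * t ^ k‖ ≤ ‖D * b ^ l * (l ! : ℝ) ^ (σ - 1)‖ * (1 / 2 : ℝ) ^ k := by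
    intro k t ht
    rw [mem_ball_zero_iff] at ht
    have h1 : a * ‖t‖ ≤ 1 / 2 := by
      have := ht.le; rw [le_div_iff₀ (by positivity)] at this; linarith
    rw [norm_mul, norm_pow]
    calc _ ≤ D * a ^ k * b ^ l * (l ! : ℝ) ^ (σ - 1) * ‖t‖ ^ k := by gcongr; exact hu k l
      _ = D * b ^ l * (l ! : ℝ) ^ (σ - 1) * (a * ‖t‖) ^ k := by rw [mul_pow]; ring
      _ ≤ ‖D * b ^ l * (l ! : ℝ) ^ (σ - 1)‖ * (1 / 2) ^ k :=
          mul_le_mul (Real.le_norm_self _) (pow_le_pow_left₀ (by positivity) h1 k)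
            (by positivity) (norm_nonneg _)
  refine ⟨Complex.differentiableOn_tsum_of_summable_norm hsum (fun k => ?_) Metric.isOpen_ball hle,
    fun t ht => (Summable.of_norm_bounded hsum fun k => hle k t ht).hasSum⟩
  exact (differentiable_const _).mul (differentiable_pow k) |>.differentiableOn

end TotChar

theorem corollary2p6 (m : ℕ) (hm : 1 ≤ m) (F : (TotChar.Var m → ℂ) → ℂ)
    (r : TotChar.Var m → ℝ) (hr : ∀ v, 0 < r v)
    (hA1 : AnalyticOnNhd ℂ F (TotChar.polydisk r))
    (hA2 : ∀ z ∈ TotChar.polydisk r, (∀ v, v ≠ TotChar.varX m → z v = 0) → F z = 0)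
    (hA3 : TotChar.TotallyCharacteristic F)
    (hN : TotChar.NonResonance F)
    (hGP : TotChar.GeneralizedPoincare F)
    (hσ : ∀ mu : ℕ, mu < m → ∀ q ∈ TotChar.indexSetMu F mu,
      TotChar.irregularity F ≤ ((m : ℝ) - q.1.1 - mu) / ((q.1.2 : ℝ) - mu)) :
    ∃ u : MvPowerSeries (Fin 2) ℂ,
      TotChar.IsFormalSolution F u ∧
      (∀ v : MvPowerSeries (Fin 2) ℂ, TotChar.IsFormalSolution F v → v = u) ∧
      u ∈ TotChar.gevreyClass 1 (TotChar.irregularity F) ∧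
      TotChar.HolomorphicInT u := by
  have hF0 : AnalyticAt ℂ F 0 := hA1 0 fun v => by simpa using hr v
  have hvan : ∀ l, MvPowerSeries.coeff (Finsupp.single (TotChar.varX m) l)
      (TotChar.taylorSeries F) = 0 := by
    refine TotChar.coeff_taylorSeries_single_eq_zero hF0 _ ?_
    filter_upwards [Metric.ball_mem_nhds (0 : ℂ) (hr (TotChar.varX m))] with x hx
    rw [mem_ball_zero_iff] at hx
    refine hA2 _ (fun v => ?_) fun v hv => Pi.single_eq_of_ne hv _
    rcases eq_or_ne v (TotChar.varX m) with rfl | hv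
    · rwa [Pi.single_eq_same]
    · rw [Pi.single_eq_of_ne hv, norm_zero]; exact hr v
  obtain ⟨u, hu0, hu⟩ := TotChar.exists_recursion F hN
  obtain ⟨R, A, ε, S, hR, hA, hε, hbound⟩ := TotChar.exists_solutionBound hm hN hGP hσ
    (TotChar.exists_norm_coeff_taylorSeries_le hF0) hu0 hu
  obtain ⟨D, a, b, hD, ha, hb, hle⟩ := TotChar.norm_coeffTX_le_of_solutionBound
    (TotChar.one_le_irregularity F) hR hA hε hu0 hbound
  refine ⟨u, (TotChar.isFormalSolution_iff hA3 hvan u).2 ⟨hu0, hu⟩, fun v hv => ?_,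
    TotChar.mem_gevreyClass_of_le hD ha hb hle, TotChar.holomorphicInT_of_le ha hle⟩
  obtain ⟨hv0, hv'⟩ := (TotChar.isFormalSolution_iff hA3 hvan v).1 hv
  exact TotChar.recursion_unique hN hv0 hu0 hv' hu
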